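/- Let $\mathbb{H}$ be the open upper half-plane, and let $\mathcal{P}_0$ be the set of analytic functions $f\colon\mathbb{H}\to\mathbb{C}$ with $\operatorname{Im} f\ge 0$ that extend analytically to a neighborhood of $0$; values, derivatives and Taylor coefficients of $f\in\mathcal{P}_0$ at $0$ are those of the extension. A function $f$ on $\mathbb{H}$ has order of contact $c>0$ with $\mathbb{R}$ at $0$ if, for some neighborhood $W$ of $0$, $f$ is analytic on $W\cap\mathbb{H}$ and maps it into $\mathbb{H}$, the limit $f(0)=\lim_{z\to0,\,z\in\mathbb{H}}f(z)$ exists and is real, and $\operatorname{Im} f(x)/|f(0)-f(x)|^{c}$ is essentially bounded above and away from zero as $x\to0$ in $\mathbb{R}$, where $f(x)$ denotes the non-tangential boundary value. For a $2\times2$ matrix $A=(a_{ij})$ put $L[A]h=\frac{a_{11}h+a_{12}}{a_{21}h+a_{22}}$, and for $a_0\in\mathbb{R}$, $a_1>0$ put \[A(a_0,a_1)(z)=\begin{bmatrix}a_0a_1z&-a_0-a_1z\\ a_1z&-1\end{bmatrix}.\] The reduction of a non-constant $f\in\mathcal{P}_0$ with $f(0)\in\mathbb{R}$ is $z\mapsto-\frac1{f(z)-f(0)}+\frac1{f'(0)z}$.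 Let $m\ge1$ and $n=2m$. (1) A function $f\colon\mathbb{H}\to\mathbb{C}$ belongs to $\mathcal{P}_0$ and has order of contact $n$ with $\mathbb{R}$ at $0$ if and only if \[f(z)=L\big[A(a_0^{(0)},a_1^{(0)})(z)\cdots A(a_0^{(m-1)},a_1^{(m-1)})(z)\big]g(z)\qquad(z\in\mathbb{H})\] for some real $a_0^{(0)},\dots,a_0^{(m-1)}$, positive $a_1^{(0)},\dots,a_1^{(m-1)}$ and some $g\in\mathcal{P}_0$ with $g(0)\in\mathbb{H}$. For each $f$ this representation is unique: $m$, the numbers $a_0^{(k)},a_1^{(k)}$ for $k<m$, and $g$ are determined by $f$. (2) Let $a_0,\dots,a_{n-1}\in\mathbb{R}$ and $a_n\in\mathbb{H}$ be such that the Hankel matrix $(a_{i+j-1})_{i,j=1}^{m}$ is positive definite. Then there is $F\in\mathcal{P}_0$ with initial Taylor coefficients $a_0,\dots,a_n$ at $0$. For every such $F$ the successive reductions $F_0=F,F_1,\dots,F_m$ are in $\mathcal{P}_0$, and the numbers $a_0^{(k)}=F_k(0)$ and $a_1^{(k)}=F_k'(0)$ for $0\le k<m$, and $a_0^{(m)}=F_m(0)$,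 do not depend on the choice of $F$; here $a_0^{(k)}\in\mathbb{R}$ and $a_1^{(k)}>0$ for $k<m$, $a_0^{(m)}\in\mathbb{H}$, $a_0^{(0)}=a_0$ and $a_1^{(0)}=a_1$. With these parameters, a function $f\colon\mathbb{H}\to\mathbb{C}$ belongs to $\mathcal{P}_0$ and has initial Taylor coefficients $a_0,\dots,a_n$ at $0$ if and only if \[f(z)=L\big[A(a_0^{(0)},a_1^{(0)})(z)\cdots A(a_0^{(m-1)},a_1^{(m-1)})(z)\big]g(z)\qquad(z\in\mathbb{H})\] for some $g\in\mathcal{P}_0$ with $g(0)=a_0^{(m)}$. -/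

import Mathlib

open Filter Topology MeasureTheory

namespace PickContact

open UpperHalfPlane

noncomputable section

/-- The Pick class: functions analytic on the open upper half-plane with nonnegative
imaginary part. -/
def IsPick (f : ℍ → ℂ) : Prop :=
  DifferentiableOn ℂ (fun z : ℂ => f (ofComplex z)) {z : ℂ | 0 < z.im} ∧
    ∀ z : ℍ, 0 ≤ (f z).im

/-- `F` is an analytic extension of `f` to a neighbourhood of `0`. -/
def IsExtensionAtZero (f : ℍ → ℂ) (F : ℂ → ℂ) : Prop :=
  AnalyticAt ℂ F 0 ∧ ∀ᶠ z : ℂ in 𝓝 0, ∀ hz : 0 < z.im, F z = f ⟨z, hz⟩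

/-- The class of Pick functions that extend analytically to a neighbourhood of `0`. -/
def IsPickZero (f : ℍ → ℂ) : Prop :=
  IsPick f ∧ ∃ F : ℂ → ℂ, IsExtensionAtZero f F

open Classical in
/-- An analytic extension of `f` to a neighbourhood of `0`, unique as a germ at `0`
(zero if there is none). -/
def extensionAtZero (f : ℍ → ℂ) : ℂ → ℂ :=
  if h : ∃ F : ℂ → ℂ, IsExtensionAtZero f F then h.choose else 0

/-- The `k`-th Taylor coefficient at `0` of a function that extends analytically to a
neighbourhood of `0`. In particular `taylorCoeff f 0` is `f(0)` and `taylorCoeff f 1` is `f'(0)`. -/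
def taylorCoeff (f : ℍ → ℂ) (k : ℕ) : ℂ :=
  iteratedDeriv k (extensionAtZero f) 0 / (k.factorial : ℂ)

/-- Two analytic extensions agree near `0`. -/
theorem IsExtensionAtZero.eventuallyEq {f : ℍ → ℂ} {F G : ℂ → ℂ}
    (hF : IsExtensionAtZero f F) (hG : IsExtensionAtZero f G) : F =ᶠ[𝓝 0] G := by
  refine (hF.1.frequently_eq_iff_eventually_eq hG.1).1 ?_
  have h1 : ∀ᶠ z : ℂ in 𝓝 0, 0 < z.im → F z = G z := by
    filter_upwards [hF.2, hG.2] with z h h' hz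
    rw [h hz, h' hz]
  have ht : Tendsto (fun t : ℝ => (t : ℂ) * Complex.I) (𝓝[>] 0) (𝓝[≠] 0) := by
    refine tendsto_nhdsWithin_iff.2 ⟨?_, ?_⟩
    · have : Continuous (fun t : ℝ => (t : ℂ) * Complex.I) := by fun_prop
      have h := this.tendsto 0
      simp only [Complex.ofReal_zero, zero_mul] at h
      exact h.mono_left nhdsWithin_le_nhds
    · filter_upwards [self_mem_nhdsWithin] with t ht
      have : (t : ℝ) ≠ 0 := ne_of_gt ht
      simp [this]
  refine ht.frequently (Eventually.frequently ?_)
  filter_upwards [ht.eventually (h1.filter_mono nhdsWithin_le_nhds), self_mem_nhdsWithin]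
    with t h ht
  exact h (by simpa using ht)

/-- Taylor coefficients may be computed from any analytic extension. -/
theorem IsExtensionAtZero.taylorCoeff_eq {f : ℍ → ℂ} {F : ℂ → ℂ}
    (hF : IsExtensionAtZero f F) (k : ℕ) :
    taylorCoeff f k = iteratedDeriv k F 0 / (k.factorial : ℂ) := by
  have h : ∃ F : ℂ → ℂ, IsExtensionAtZero f F := ⟨F, hF⟩
  have h2 : IsExtensionAtZero f (extensionAtZero f) := by
    unfold extensionAtZero
    rw [dif_pos h]
    exact h.choose_spec
  unfold taylorCoeff
  rw [(h2.eventuallyEq hF).iteratedDeriv_eq k]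

/-- `w` is the non-tangential limit of `f` at the real point `x`. -/
def HasNontangentialLimit (f : ℍ → ℂ) (x : ℝ) (w : ℂ) : Prop :=
  ∀ M : ℝ, 0 < M →
    Tendsto f (comap ((↑) : ℍ → ℂ) (𝓝 (x : ℂ)) ⊓ 𝓟 {z : ℍ | |z.re - x| ≤ M * z.im}) (𝓝 w)

/-- `f` has contact of order `c > 0` with the real line at `0`: near `0` it is analytic on the
upper half-plane and maps it into itself, it has a real unrestricted limit `L = f(0)` at `0`, and
the quotient `im f(x) / |f(0) - f(x)| ^ c`, formed with the non-tangential boundary values `f(x)`,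
is essentially bounded above and away from zero as `x → 0` along the real line. -/
def HasContactOrder (f : ℍ → ℂ) (c : ℝ) : Prop :=
  0 < c ∧
  (∃ W ∈ 𝓝 (0 : ℂ),
    DifferentiableOn ℂ (fun z : ℂ => f (ofComplex z)) (W ∩ {z : ℂ | 0 < z.im}) ∧
    ∀ z : ℍ, (z : ℂ) ∈ W → 0 < (f z).im) ∧
  ∃ L : ℝ, Tendsto f (comap ((↑) : ℍ → ℂ) (𝓝 0)) (𝓝 (L : ℂ)) ∧
    ∃ δ > 0, ∃ C₁ > 0, ∃ C₂ > 0, ∀ᵐ x : ℝ ∂volume, |x| < δ →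
      ∃ w : ℂ, HasNontangentialLimit f x w ∧
        C₁ ≤ w.im / ‖(L : ℂ) - w‖ ^ c ∧ w.im / ‖(L : ℂ) - w‖ ^ c ≤ C₂

/-- The linear fractional transformation `L[A]`. -/
def lft (A : Matrix (Fin 2) (Fin 2) ℂ) (h : ℂ) : ℂ :=
  (A 0 0 * h + A 0 1) / (A 1 0 * h + A 1 1)

/-- The matrix `A(a₀, a₁)(z)` of the augmentation by `a₀, a₁`. -/
def augMatrix (a₀ a₁ : ℝ) (z : ℂ) : Matrix (Fin 2) (Fin 2) ℂ :=
  !![a₀ * a₁ * z, -a₀ - a₁ * z; a₁ * z, -1]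

/-- The ordered product `A(p 0, q 0)(z) * ⋯ * A(p (m-1), q (m-1))(z)`. -/
def augProd (m : ℕ) (p q : ℕ → ℝ) (z : ℂ) : Matrix (Fin 2) (Fin 2) ℂ :=
  ((List.range m).map fun k => augMatrix (p k) (q k) z).prod

/-- The reduction of `f` at `0`. -/
def reduction (f : ℍ → ℂ) : ℍ → ℂ := fun z =>
  -1 / (f z - taylorCoeff f 0) + 1 / (taylorCoeff f 1 * (z : ℂ))

/-- The Hankel matrix `H_m(a_1, …, a_{2m-1})`, with entry `a_{i+j-1}` in row `i` and column `j`
(rows and columns numbered from `1`). -/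
def hankel (m : ℕ) (a : ℕ → ℝ) : Matrix (Fin m) (Fin m) ℝ :=
  Matrix.of fun i j => a (i.val + j.val + 1)

/-- `f` has initial Taylor coefficients `a 0, …, a (n-1), α` at `0`. -/
def HasInitialCoeffs (f : ℍ → ℂ) (n : ℕ) (a : ℕ → ℝ) (α : ℂ) : Prop :=
  (∀ k < n, taylorCoeff f k = (a k : ℂ)) ∧ taylorCoeff f n = α

end

end PickContact

/-!
Everything rests on two facts about one step `f = aug p q g`, that is
`f z = p + q z / (1 - q z g z)` or, equivalently, `g z = -1 / (f z - p) + 1 / (q z)`.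

* If `f` is a non-constant function of the class with `f(0)` real, its reduction `g` is again in
  the class (`IsPickZero.exists_eq_aug`). Nonnegativity of `Im g` is exactly Julia's inequality
  `|f z - f(0)|² Im z ≤ f'(0) |z|² Im f z` (`julia`), the limit of the Schwarz–Pick inequality
  (`schwarzPick`) as one of the two points tends to `0`; the same inequality shows `f'(0) > 0`.
* For real `x`, `Im f x` is `x ^ 2` times a factor with positive limit times `Im g x`. Hence `Im f`
  vanishes on the real axis to order `n + 2` if and only if `Im g` vanishes to order `n`
  (`hasImOrder_aug_iff`).

Since `|f(0) - f x|` is comparable to `|x|`, contact of order `2 m` means that `Im f x` is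
comparable to `x ^ (2 m)` (`hasContactOrder_iff`). After `m` reductions the order is `0`, which says
that the value at `0` lies in `ℍ`; conversely `m` augmentations of such a function have order
`2 m`. Uniqueness holds because `p = f(0)`, `q = f'(0)`, and `g` is the reduction of `f`; the number
of steps is the first at which the value at `0` is not real.

For the coefficient problem, prescribed coefficients that are real below index `2 m` and end with
`α ∈ ℍ` force `Im f x ∼ x ^ (2 m) Im α`, so every solution has an augmentation representation.
Augmentation shifts agreement of Taylor coefficients by exactly two places
(`taylorCoeff_aug_eq_iff`), so the parameters and the value `g(0)` are the same for all solutions,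
and any `g` with that value at `0` yields a solution. Positive definiteness of the Hankel matrix is
needed only for the existence of one solution, which is written down as a resolvent
(`exists_hasInitialCoeffs`).
-/

namespace PickContact

open UpperHalfPlane Matrix
open scoped Asymptotics ComplexOrder

/-! ### The Schwarz–Pick and Julia inequalities -/

theorem normSq_sub_conj (u v : ℂ) :
    Complex.normSq (u - (starRingEnd ℂ) v) = Complex.normSq (u - v) + 4 * (u.im * v.im) := by
  simp only [Complex.normSq_apply, Complex.sub_re, Complex.sub_im, Complex.conj_re,
    Complex.conj_im]
  ring

theorem sub_conj_ne_zero {u v : ℂ} (hu : 0 < u.im) (hv : 0 < v.im) :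
    u - (starRingEnd ℂ) v ≠ 0 := by
  intro h
  have := congrArg Complex.im h
  simp at this
  linarith

/-- The Schwarz–Pick inequality for analytic self-maps of the upper half-plane. The Schwarz lemma
is applied after moving `w` and `φ w` to the origin of the disc by Cayley transforms. -/
theorem schwarzPick {φ : ℂ → ℂ} (hd : DifferentiableOn ℂ φ {z : ℂ | 0 < z.im})
    (hpos : ∀ z : ℂ, 0 < z.im → 0 < (φ z).im) {z w : ℂ} (hz : 0 < z.im) (hw : 0 < w.im) :
    Complex.normSq (φ z - φ w) * (z.im * w.im) ≤
      Complex.normSq (z - w) * ((φ z).im * (φ w).im) := by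
  set C : ℂ → ℂ := fun ζ => (w - (starRingEnd ℂ) w * ζ) / (1 - ζ) with hC
  set D : ℂ → ℂ := fun u => (u - φ w) / (u - (starRingEnd ℂ) (φ w)) with hD
  have hne : ∀ ζ ∈ Metric.ball (0 : ℂ) 1, (1 : ℂ) - ζ ≠ 0 := by
    intro ζ hζ h
    rw [sub_eq_zero] at h
    simp [← h] at hζ
  have hCim : ∀ ζ ∈ Metric.ball (0 : ℂ) 1, 0 < (C ζ).im := by
    intro ζ hζ
    have h1 : 0 < Complex.normSq (1 - ζ) := Complex.normSq_pos.2 (hne ζ hζ)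
    have h2 : Complex.normSq ζ < 1 := by
      rw [Complex.normSq_eq_norm_sq]
      have : ‖ζ‖ < 1 := by simpa using hζ
      nlinarith [norm_nonneg ζ]
    have : (C ζ).im = w.im * (1 - Complex.normSq ζ) / Complex.normSq (1 - ζ) := by
      simp only [hC, Complex.div_im, Complex.sub_re, Complex.sub_im, Complex.mul_re,
        Complex.mul_im, Complex.conj_re, Complex.conj_im, Complex.one_re, Complex.one_im]
      rw [← sub_div, Complex.normSq_apply ζ]
      congr 1
      ring
    rw [this]
    have : 0 < 1 - Complex.normSq ζ := by linarith
    positivity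
  have hDle : ∀ u : ℂ, 0 < u.im → ‖D u‖ ≤ 1 := by
    intro u hu
    have h0 : 0 < ‖u - (starRingEnd ℂ) (φ w)‖ :=
      norm_pos_iff.2 (sub_conj_ne_zero hu (hpos w hw))
    rw [hD, norm_div, div_le_one h0, ← sq_le_sq₀ (norm_nonneg _) (norm_nonneg _),
      ← Complex.normSq_eq_norm_sq, ← Complex.normSq_eq_norm_sq, normSq_sub_conj]
    have := mul_pos hu (hpos w hw)
    linarith
  have hC0 : C 0 = w := by simp [hC]
  set ζ : ℂ := (z - w) / (z - (starRingEnd ℂ) w) with hζ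
  have hzw := sub_conj_ne_zero hz hw
  have hzw' : 0 < Complex.normSq (z - (starRingEnd ℂ) w) := Complex.normSq_pos.2 hzw
  have hfzw := sub_conj_ne_zero (hpos z hz) (hpos w hw)
  have hfzw' : 0 < Complex.normSq (φ z - (starRingEnd ℂ) (φ w)) := Complex.normSq_pos.2 hfzw
  have hzwim : 0 < z.im * w.im := mul_pos hz hw
  have hζ1 : ‖ζ‖ < 1 := by
    rw [hζ, norm_div, div_lt_one (norm_pos_iff.2 hzw),
      ← sq_lt_sq₀ (norm_nonneg _) (norm_nonneg _),
      ← Complex.normSq_eq_norm_sq, ← Complex.normSq_eq_norm_sq, normSq_sub_conj]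
    linarith
  have hwim : w - (starRingEnd ℂ) w ≠ 0 := sub_conj_ne_zero hw hw
  have hCζ : C ζ = z := by
    have h1 : (1 : ℂ) - ζ = (w - (starRingEnd ℂ) w) / (z - (starRingEnd ℂ) w) := by
      rw [hζ]; field_simp; ring
    have h2 : w - (starRingEnd ℂ) w * ζ
        = z * (w - (starRingEnd ℂ) w) / (z - (starRingEnd ℂ) w) := by
      rw [hζ]; field_simp; ring
    simp only [hC]
    rw [h1, h2]
    field_simp
  have hdiff : DifferentiableOn ℂ (fun ζ => D (φ (C ζ))) (Metric.ball (0 : ℂ) 1) := by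
    have hCd : DifferentiableOn ℂ C (Metric.ball (0 : ℂ) 1) := by
      apply DifferentiableOn.div (by fun_prop) (by fun_prop) hne
    have h1 := hd.comp hCd hCim
    exact (h1.sub_const _).div (h1.sub_const _)
      fun ζ hζ => sub_conj_ne_zero (hpos _ (hCim ζ hζ)) (hpos w hw)
  have key := Complex.norm_le_norm_of_mapsTo_ball (z := ζ) hdiff
    (fun ζ hζ => by simpa using hDle _ (hpos _ (hCim ζ hζ))) (by simp [hC0, hD]) hζ1
  rw [hCζ, ← sq_le_sq₀ (norm_nonneg _) (norm_nonneg _), ← Complex.normSq_eq_norm_sq,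
    ← Complex.normSq_eq_norm_sq, hD, hζ, Complex.normSq_div, Complex.normSq_div,
    div_le_div_iff₀ hfzw' hzw', normSq_sub_conj, normSq_sub_conj] at key
  linarith

theorem tendsto_ofReal_mul_I :
    Tendsto (fun t : ℝ => (t : ℂ) * Complex.I) (𝓝[>] 0) (𝓝 0) := by
  have : Continuous (fun t : ℝ => (t : ℂ) * Complex.I) := by fun_prop
  have h := this.tendsto 0
  simp only [Complex.ofReal_zero, zero_mul] at h
  exact h.mono_left nhdsWithin_le_nhds

theorem IsExtensionAtZero.taylorCoeff_zero {f : ℍ → ℂ} {F : ℂ → ℂ}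
    (hF : IsExtensionAtZero f F) : taylorCoeff f 0 = F 0 := by
  simp [hF.taylorCoeff_eq]

theorem IsExtensionAtZero.taylorCoeff_one {f : ℍ → ℂ} {F : ℂ → ℂ}
    (hF : IsExtensionAtZero f F) : taylorCoeff f 1 = deriv F 0 := by
  simp [hF.taylorCoeff_eq]

/-- Julia's inequality at the boundary point `0`: the limit of the Schwarz–Pick inequality as one
of the two points tends to `0` along the imaginary axis. -/
theorem julia {f : ℍ → ℂ} {F : ℂ → ℂ} (hf : IsPick f) (hpos : ∀ z, 0 < (f z).im)
    (hF : IsExtensionAtZero f F) (h0 : (F 0).im = 0) (z : ℍ) :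
    Complex.normSq (f z - F 0) * z.im ≤
      (deriv F 0).re * (Complex.normSq (z : ℂ) * (f z).im) := by
  have hsp : ∀ᶠ t : ℝ in 𝓝[>] 0,
      Complex.normSq (f z - F (t * Complex.I)) * z.im ≤
        Complex.normSq ((z : ℂ) - t * Complex.I) *
          ((f z).im * (t⁻¹ * (F (t * Complex.I)).im)) := by
    filter_upwards [tendsto_ofReal_mul_I.eventually hF.2, self_mem_nhdsWithin] with t ht ht0
    have ht0 : 0 < t := ht0
    have him : 0 < ((t : ℂ) * Complex.I).im := by simpa using ht0
    have := schwarzPick (φ := fun z => f (ofComplex z)) hf.1 (fun z _ => hpos _)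
      (z := z) (w := t * Complex.I) z.im_pos him
    rw [ofComplex_apply, ofComplex_apply_of_im_pos him, ← ht him] at this
    simp only [Complex.mul_im, Complex.ofReal_re, Complex.I_im, mul_one, Complex.ofReal_im,
      Complex.I_re, mul_zero, add_zero, UpperHalfPlane.coe_im] at this
    have h2 := mul_le_mul_of_nonneg_right this (inv_nonneg.2 ht0.le)
    calc _ = Complex.normSq (f z - F (t * Complex.I)) * (z.im * t) * t⁻¹ := by field_simp
      _ ≤ _ := h2
      _ = _ := by ring
  have hFc : Tendsto (fun t : ℝ => F (t * Complex.I)) (𝓝[>] 0) (𝓝 (F 0)) :=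
    hF.1.continuousAt.tendsto.comp tendsto_ofReal_mul_I
  have hder : HasDerivAt (fun t : ℝ => (F (t * Complex.I)).im) (deriv F 0).re 0 := by
    have h1 : HasDerivAt (fun t : ℝ => (t : ℂ) * Complex.I) Complex.I 0 := by
      simpa using (Complex.ofRealCLM.hasDerivAt (x := 0)).mul_const Complex.I
    have h2 : HasDerivAt F (deriv F 0) (((0 : ℝ) : ℂ) * Complex.I) := by
      simpa using hF.1.differentiableAt.hasDerivAt
    have h3 := h2.comp (0 : ℝ) h1
    have h4 := Complex.imCLM.hasFDerivAt.comp_hasDerivAt (0 : ℝ) h3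
    have h5 : Complex.imCLM (deriv F 0 * Complex.I) = (deriv F 0).re := by simp
    rw [h5] at h4
    exact h4
  have hslope : Tendsto (fun t : ℝ => t⁻¹ * (F (t * Complex.I)).im) (𝓝[>] 0)
      (𝓝 (deriv F 0).re) := by
    have := (hasDerivAt_iff_tendsto_slope_zero.1 hder).mono_left
      (nhdsWithin_mono 0 (show Set.Ioi (0 : ℝ) ⊆ {0}ᶜ from fun t ht => ne_of_gt ht))
    simpa [h0] using this
  have hnc : Continuous Complex.normSq := Complex.continuous_normSq
  have hL : Tendsto (fun t : ℝ => Complex.normSq (f z - F (t * Complex.I)) * z.im) (𝓝[>] 0)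
      (𝓝 (Complex.normSq (f z - F 0) * z.im)) :=
    ((hnc.tendsto _).comp (tendsto_const_nhds.sub hFc)).mul_const _
  have hR := ((hnc.tendsto _).comp
    ((tendsto_const_nhds (x := (z : ℂ))).sub tendsto_ofReal_mul_I)).mul
      (hslope.const_mul (f z).im)
  have := le_of_tendsto_of_tendsto hL hR hsp
  simp only [sub_zero] at this
  linarith

/-- By the open mapping theorem, a Pick function that takes a real value is constant. -/
theorem IsPick.im_pos_or_const {f : ℍ → ℂ} (hf : IsPick f) :
    (∀ z, 0 < (f z).im) ∨ ∃ r : ℝ, ∀ z, f z = r := by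
  have hopen : IsOpen {z : ℂ | 0 < z.im} := isOpen_lt continuous_const Complex.continuous_im
  have hconv : Convex ℝ {z : ℂ | 0 < z.im} := convex_halfSpace_im_gt 0
  by_contra! hcon
  obtain ⟨⟨z₀, hz₀⟩, hnc⟩ := hcon
  have hz₀' : (f z₀).im = 0 := le_antisymm hz₀ (hf.2 z₀)
  rcases (hf.1.analyticOnNhd hopen).is_constant_or_isOpen hconv.isPreconnected with ⟨w, hw⟩ | h
  · obtain ⟨z, hz⟩ := hnc w.re
    have h0 := hw z₀ z₀.im_pos
    have h1 := hw z z.im_pos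
    rw [ofComplex_apply] at h0 h1
    refine hz ?_
    rw [h1]
    apply Complex.ext <;> simp [← h0, hz₀']
  · -- an open image containing a real value contains values below the real axis
    have ho := h _ subset_rfl hopen
    have hmem : f z₀ ∈ (fun z : ℂ => f (ofComplex z)) '' {z : ℂ | 0 < z.im} :=
      ⟨z₀, z₀.im_pos, by simp⟩
    have htend : Tendsto (fun t : ℝ => f z₀ - (t : ℂ) * Complex.I) (𝓝[>] 0) (𝓝 (f z₀)) := by
      simpa using (tendsto_const_nhds (x := f z₀)).sub tendsto_ofReal_mul_I
    obtain ⟨t, ht, ht0⟩ :=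
      ((htend.eventually (ho.mem_nhds hmem)).and self_mem_nhdsWithin).exists
    have ht0 : 0 < t := ht0
    obtain ⟨u, hu, hu2⟩ := ht
    have := congrArg Complex.im hu2
    have h3 := hf.2 (ofComplex u)
    simp [hz₀'] at this
    linarith

/-! ### Augmentation and reduction -/

/-- The augmentation of `g` by `p, q`, that is `z ↦ L[A(p, q)(z)] (g z)`. -/
noncomputable def aug (p q : ℝ) (g : ℍ → ℂ) : ℍ → ℂ := fun z => lft (augMatrix p q z) (g z)

/-- The augmentation written as a function on `ℂ`; it extends `aug p q g` to a neighbourhood of `0`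
when `G` extends `g`. -/
noncomputable def augExt (p q : ℝ) (G : ℂ → ℂ) : ℂ → ℂ := fun z => p + q * z / (1 - q * z * G z)

theorem one_sub_mul_ne_zero {q : ℝ} (hq : 0 < q) {z h : ℂ} (hz : 0 < z.im) (hh : 0 ≤ h.im) :
    1 - q * z * h ≠ 0 := by
  intro h0
  have hz0 : z ≠ 0 := fun h => by simp [h] at hz
  have h1 : q * h = z⁻¹ := by
    field_simp
    linear_combination -h0
  have h2 := congrArg Complex.im h1
  rw [Complex.im_ofReal_mul, Complex.inv_im] at h2
  have h3 : 0 < z.im / Complex.normSq z := div_pos hz (Complex.normSq_pos.2 hz0)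
  have h4 : 0 ≤ q * h.im := by positivity
  rw [h2, neg_div] at h4
  linarith

theorem lft_augMatrix (p q : ℝ) {z h : ℂ} (hd : 1 - q * z * h ≠ 0) :
    lft (augMatrix p q z) h = p + q * z / (1 - q * z * h) := by
  have hd' : q * z * h + -1 ≠ 0 := fun h0 => hd (by linear_combination -h0)
  simp only [lft, augMatrix, Matrix.of_apply, Matrix.cons_val', Matrix.cons_val_zero,
    Matrix.cons_val_one, Matrix.cons_val_fin_one]
  rw [div_eq_iff hd', add_mul, div_mul_eq_mul_div, eq_comm, ← sub_eq_zero]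
  field_simp
  ring

section aug

variable {p q : ℝ} {g : ℍ → ℂ}

theorem aug_apply (hq : 0 < q) (hg : ∀ z, 0 ≤ (g z).im) (z : ℍ) :
    aug p q g z = p + q * z / (1 - q * z * g z) :=
  lft_augMatrix p q (one_sub_mul_ne_zero hq z.im_pos (hg z))

theorem neg_one_div_aug_sub (hq : 0 < q) (hg : ∀ z, 0 ≤ (g z).im) (z : ℍ) :
    -1 / (aug p q g z - p) + 1 / (q * z) = g z := by
  have h1 := one_sub_mul_ne_zero hq z.im_pos (hg z)
  have h2 : (q : ℂ) ≠ 0 := by exact_mod_cast hq.ne'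
  have h3 : (z : ℂ) ≠ 0 := z.ne_zero
  rw [aug_apply hq hg, add_sub_cancel_left]
  field_simp
  ring

theorem im_neg_one_div (w : ℂ) : (-1 / w).im = w.im / Complex.normSq w := by
  rw [neg_div, one_div, Complex.neg_im, Complex.inv_im, neg_div, neg_neg]

theorem im_one_div_ofReal_mul (q : ℝ) (z : ℂ) :
    (1 / (q * z)).im = -(q⁻¹ * (z.im / Complex.normSq z)) := by
  have : 1 / (q * z) = ((q⁻¹ : ℝ) : ℂ) * z⁻¹ := by push_cast; rw [one_div, mul_inv]
  rw [this, Complex.im_ofReal_mul, Complex.inv_im]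
  ring

theorem aug_im_pos (hq : 0 < q) (hg : ∀ z, 0 ≤ (g z).im) (z : ℍ) : 0 < (aug p q g z).im := by
  have h1 := congrArg Complex.im (neg_one_div_aug_sub (p := p) hq hg z)
  rw [Complex.add_im, im_neg_one_div, im_one_div_ofReal_mul] at h1
  have h2 : 0 < q⁻¹ * ((z : ℂ).im / Complex.normSq z) :=
    mul_pos (inv_pos.2 hq) (div_pos z.im_pos z.normSq_pos)
  have h3 : 0 < (aug p q g z - p).im / Complex.normSq (aug p q g z - p) := by
    linarith [hg z]
  by_contra! h4
  have : (aug p q g z - p).im / Complex.normSq (aug p q g z - p) ≤ 0 :=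
    div_nonpos_of_nonpos_of_nonneg (by simpa using h4) (Complex.normSq_nonneg _)
  linarith

theorem IsPick.augment (hq : 0 < q) (hg : IsPick g) : IsPick (aug p q g) := by
  refine ⟨?_, fun z => (aug_im_pos hq hg.2 z).le⟩
  have h : DifferentiableOn ℂ
      (fun z : ℂ => (p : ℂ) + q * z / (1 - q * z * g (ofComplex z))) {z : ℂ | 0 < z.im} :=
    (differentiableOn_const _).add (DifferentiableOn.div (by fun_prop)
      ((differentiableOn_const _).sub (DifferentiableOn.mul (by fun_prop) hg.1))
      fun z hz => one_sub_mul_ne_zero hq hz (hg.2 _))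
  refine h.congr fun z hz => ?_
  rw [aug_apply hq hg.2, ofComplex_apply_of_im_pos hz]

theorem augExt_den_ne_zero {G : ℂ → ℂ} (hG : ContinuousAt G 0) :
    ∀ᶠ z : ℂ in 𝓝 0, 1 - q * z * G z ≠ 0 := by
  have : ContinuousAt (fun z : ℂ => 1 - q * z * G z) 0 := by fun_prop
  exact this.eventually_ne (by simp)

theorem augExt_analyticAt {G : ℂ → ℂ} (hG : AnalyticAt ℂ G 0) :
    AnalyticAt ℂ (augExt p q G) 0 := by
  unfold augExt
  exact analyticAt_const.add ((analyticAt_const.mul analyticAt_id).div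
    (analyticAt_const.sub ((analyticAt_const.mul analyticAt_id).mul hG)) (by simp))

theorem IsExtensionAtZero.augment (hq : 0 < q) (hg : ∀ z, 0 ≤ (g z).im) {G : ℂ → ℂ}
    (hG : IsExtensionAtZero g G) : IsExtensionAtZero (aug p q g) (augExt p q G) := by
  refine ⟨augExt_analyticAt hG.1, ?_⟩
  filter_upwards [hG.2] with z h hz
  rw [aug_apply hq hg, augExt, h hz]

theorem augExt_zero (p q : ℝ) (G : ℂ → ℂ) : augExt p q G 0 = p := by simp [augExt]

theorem deriv_augExt_zero {G : ℂ → ℂ} (hG : AnalyticAt ℂ G 0) :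
    deriv (augExt p q G) 0 = q := by
  have h1 : HasDerivAt (fun z : ℂ => (q : ℂ) * z) q 0 := by
    simpa using (hasDerivAt_id (0 : ℂ)).const_mul (q : ℂ)
  have h2 := (h1.mul hG.differentiableAt.hasDerivAt).const_sub 1
  have h3 := (h1.div h2 (by simp)).const_add (p : ℂ)
  have := h3.deriv
  simp only [Pi.mul_apply, mul_zero, zero_mul, sub_zero, mul_one, one_pow, div_one] at this
  exact this

theorem IsPickZero.augment (hq : 0 < q) (hg : IsPickZero g) : IsPickZero (aug p q g) :=
  ⟨hg.1.augment hq, hg.2.imp' (augExt p q) fun _ hG => hG.augment hq hg.1.2⟩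

theorem taylorCoeff_aug_zero (hq : 0 < q) (hg : IsPickZero g) :
    taylorCoeff (aug p q g) 0 = p := by
  obtain ⟨G, hG⟩ := hg.2
  rw [(hG.augment hq hg.1.2).taylorCoeff_zero, augExt_zero]

theorem taylorCoeff_aug_one (hq : 0 < q) (hg : IsPickZero g) :
    taylorCoeff (aug p q g) 1 = q := by
  obtain ⟨G, hG⟩ := hg.2
  rw [(hG.augment hq hg.1.2).taylorCoeff_one, deriv_augExt_zero hG.1]

/-- Reduction undoes augmentation. -/
theorem reduction_aug (hq : 0 < q) (hg : IsPickZero g) : reduction (aug p q g) = g := by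
  funext z
  rw [reduction, taylorCoeff_aug_zero hq hg, taylorCoeff_aug_one hq hg]
  exact neg_one_div_aug_sub hq hg.1.2 z

end aug

theorem IsExtensionAtZero.im_nonneg {f : ℍ → ℂ} {F : ℂ → ℂ} (hf : IsPick f)
    (hF : IsExtensionAtZero f F) : ∀ᶠ x : ℝ in 𝓝 0, 0 ≤ (F x).im := by
  have hc : Tendsto (fun x : ℝ => (x : ℂ)) (𝓝 0) (𝓝 0) := by
    simpa using Complex.continuous_ofReal.tendsto 0
  filter_upwards [hc.eventually hF.2.eventually_nhds, hc.eventually hF.1.eventually_analyticAt]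
    with x hx hxa
  have ht : Tendsto (fun t : ℝ => (x : ℂ) + t * Complex.I) (𝓝[>] 0) (𝓝 x) := by
    simpa using tendsto_ofReal_mul_I.const_add (x : ℂ)
  refine ge_of_tendsto
    ((Complex.continuous_im.tendsto _).comp (hxa.continuousAt.tendsto.comp ht)) ?_
  filter_upwards [ht.eventually hx, self_mem_nhdsWithin] with t h ht0
  have ht0 : 0 < t := ht0
  simp only [Function.comp_apply]
  rw [h (by simpa using ht0)]
  exact hf.2 _

/-- On the real axis the imaginary part of the extension has a minimum at `0`, so that the
derivative at `0` is real. -/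
theorem IsExtensionAtZero.deriv_im {f : ℍ → ℂ} {F : ℂ → ℂ} (hf : IsPick f)
    (hF : IsExtensionAtZero f F) (h0 : (F 0).im = 0) : (deriv F 0).im = 0 := by
  have h2 : HasDerivAt F (deriv F 0) ((0 : ℝ) : ℂ) := by
    simpa using hF.1.differentiableAt.hasDerivAt
  have h4 : HasDerivAt (fun x : ℝ => (F x).im) (deriv F 0).im 0 :=
    Complex.imCLM.hasFDerivAt.comp_hasDerivAt (0 : ℝ) h2.comp_ofReal
  refine IsLocalMin.hasDerivAt_eq_zero ?_ h4
  filter_upwards [hF.im_nonneg hf] with x hx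
  simpa [h0] using hx

/-- A Pick function that takes a real value at `0` without being constant is the augmentation of
its reduction, and the reduction is again a Pick function by Julia's inequality. -/
theorem IsPickZero.exists_eq_aug {f : ℍ → ℂ} (hf : IsPickZero f) (hpos : ∀ z, 0 < (f z).im)
    (h0 : (taylorCoeff f 0).im = 0) :
    ∃ p q : ℝ, 0 < q ∧ ∃ g, IsPickZero g ∧ f = aug p q g := by
  obtain ⟨F, hF⟩ := hf.2
  rw [hF.taylorCoeff_zero] at h0
  obtain ⟨p, hp⟩ : ∃ p : ℝ, F 0 = p := ⟨(F 0).re, Complex.ext (by simp) (by simp [h0])⟩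
  obtain ⟨q, hq⟩ : ∃ q : ℝ, deriv F 0 = q :=
    ⟨(deriv F 0).re, Complex.ext (by simp) (by simp [hF.deriv_im hf.1 h0])⟩
  have hfp : ∀ z, f z - p ≠ 0 := fun z h => by
    have := congrArg Complex.im h
    simp [(hpos z).ne'] at this
  have hJ := fun z => julia hf.1 hpos hF h0 z
  simp only [hp, hq, Complex.ofReal_re] at hJ
  have hq0 : 0 < q := by
    have h1 := hJ UpperHalfPlane.I
    have h2 : 0 < Complex.normSq (f UpperHalfPlane.I - p) * UpperHalfPlane.I.im :=
      mul_pos (Complex.normSq_pos.2 (hfp _)) UpperHalfPlane.I.im_pos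
    have h3 : 0 ≤ Complex.normSq (UpperHalfPlane.I : ℂ) * (f UpperHalfPlane.I).im :=
      mul_nonneg (Complex.normSq_nonneg _) (hpos _).le
    exact pos_of_mul_pos_left (h2.trans_le h1) h3
  have hqc : (q : ℂ) ≠ 0 := by exact_mod_cast hq0.ne'
  set g : ℍ → ℂ := fun z => -1 / (f z - p) + 1 / (q * z) with hg
  have hgim : ∀ z, 0 ≤ (g z).im := by
    intro z
    have h1 : 0 < Complex.normSq (f z - p) := Complex.normSq_pos.2 (hfp z)
    have h2 : 0 < Complex.normSq (z : ℂ) := z.normSq_pos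
    rw [hg, Complex.add_im, im_neg_one_div, im_one_div_ofReal_mul, ← sub_eq_add_neg, sub_nonneg,
      inv_mul_le_iff₀ hq0, mul_div_assoc', div_le_div_iff₀ h2 h1, Complex.sub_im,
      Complex.ofReal_im, sub_zero]
    have := hJ z
    simp only [UpperHalfPlane.coe_im]
    linarith
  refine ⟨p, q, hq0, g, ⟨⟨?_, hgim⟩, ?_⟩, ?_⟩
  · have h : DifferentiableOn ℂ
        (fun z : ℂ => -1 / (f (ofComplex z) - p) + 1 / (q * z)) {z : ℂ | 0 < z.im} := by
      refine ((differentiableOn_const _).div (hf.1.1.sub_const _) fun z _ => hfp _).add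
        ((differentiableOn_const _).div (by fun_prop) fun z hz => mul_ne_zero hqc ?_)
      rintro rfl
      simp at hz
    refine h.congr fun z hz => ?_
    rw [hg, ofComplex_apply_of_im_pos hz]
  · -- with `F z = p + z K z` and `K z = q + z K₁ z`, the reduction is `K₁ / (q K)`
    have hda : ∀ {H : ℂ → ℂ}, AnalyticAt ℂ H 0 → AnalyticAt ℂ (dslope H 0) 0 := by
      rintro H ⟨P, hP⟩
      exact ⟨_, hP.has_fpower_series_dslope_fslope⟩
    have hK := hda hF.1
    have hK0 : dslope F 0 0 = q := by rw [dslope_same, hq]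
    refine ⟨fun z => dslope (dslope F 0) 0 z / (q * dslope F 0 z),
      (hda hK).div (analyticAt_const.mul hK) (by rw [hK0]; exact mul_ne_zero hqc hqc), ?_⟩
    filter_upwards [hF.2] with z hz hzim
    have hz0 : z ≠ 0 := fun h => by simp [h] at hzim
    have e1 : f ⟨z, hzim⟩ - p = z * dslope F 0 z := by
      have := sub_smul_dslope F 0 z
      rw [smul_eq_mul, hz hzim, hp] at this
      simpa using this.symm
    have e2 : dslope F 0 z = q + z * dslope (dslope F 0) 0 z := by
      have := sub_smul_dslope (dslope F 0) 0 z
      rw [smul_eq_mul, hK0] at this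
      linear_combination -this
    have hKz : dslope F 0 z ≠ 0 := fun h => hfp ⟨z, hzim⟩ (by rw [e1, h, mul_zero])
    simp only [hg]
    rw [e1]
    field_simp
    linear_combination -e2
  · funext z
    rw [aug_apply hq0 hgim]
    have hz0 : (z : ℂ) ≠ 0 := z.ne_zero
    have e : 1 - (q : ℂ) * z * g z = q * z / (f z - p) := by
      have := hfp z
      simp only [hg]
      field_simp
      ring
    rw [e, div_div_cancel₀ (mul_ne_zero hqc hz0)]
    ring

/-! ### Growth of the imaginary part on the real axis -/

/-- The imaginary part of the extension of `f` across `0` is comparable on the real axis to `x ^ n`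
as `x → 0`. The point `0` itself is left out, so that factors `x ^ 2` can be cancelled. -/
def HasImOrder (f : ℍ → ℂ) (n : ℕ) : Prop :=
  ∃ F : ℂ → ℂ, IsExtensionAtZero f F ∧ (fun x : ℝ => (F x).im) =Θ[𝓝[≠] 0] fun x => x ^ n

theorem tendsto_ofReal_zero : Tendsto (fun x : ℝ => (x : ℂ)) (𝓝 0) (𝓝 0) := by
  simpa using Complex.continuous_ofReal.tendsto 0

theorem tendsto_ofReal_zero_ne : Tendsto (fun x : ℝ => (x : ℂ)) (𝓝[≠] 0) (𝓝 0) :=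
  tendsto_ofReal_zero.mono_left nhdsWithin_le_nhds

theorem tendsto_im_extension {F : ℂ → ℂ} (hF : AnalyticAt ℂ F 0) :
    Tendsto (fun x : ℝ => (F x).im) (𝓝[≠] 0) (𝓝 (F 0).im) :=
  (Complex.continuous_im.tendsto _).comp (hF.continuousAt.tendsto.comp tendsto_ofReal_zero_ne)

theorem IsExtensionAtZero.hasImOrder_iff {f : ℍ → ℂ} {F : ℂ → ℂ} (hF : IsExtensionAtZero f F)
    (n : ℕ) : HasImOrder f n ↔ (fun x : ℝ => (F x).im) =Θ[𝓝[≠] 0] fun x => x ^ n := by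
  refine ⟨fun ⟨G, hG, h⟩ => ?_, fun h => ⟨F, hF, h⟩⟩
  refine (EventuallyEq.isTheta ?_).trans h
  filter_upwards [tendsto_ofReal_zero_ne.eventually (hF.eventuallyEq hG)] with x hx
  rw [hx]

/-- The identity behind the gain of two orders of contact under augmentation. It needs no condition
on the denominator, since both sides vanish with it. -/
theorem im_augExt_ofReal (p q : ℝ) (G : ℂ → ℂ) (x : ℝ) :
    (augExt p q G x).im = (q ^ 2 / Complex.normSq (1 - q * x * G x)) * (x ^ 2 * (G x).im) := by
  have e : augExt p q G x = p + ((q * x : ℝ) : ℂ) * (1 - q * x * G x)⁻¹ := by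
    simp [augExt, div_eq_mul_inv]
  have him : (1 - (q : ℂ) * x * G x).im = -(q * x * (G x).im) := by
    rw [← Complex.ofReal_mul, Complex.sub_im, Complex.im_ofReal_mul]
    simp
  rw [e, Complex.add_im, Complex.im_ofReal_mul, Complex.inv_im, him, Complex.ofReal_im]
  ring

theorem hasImOrder_aug_iff {p q : ℝ} {g : ℍ → ℂ} (hq : 0 < q) (hg : IsPickZero g) (n : ℕ) :
    HasImOrder (aug p q g) (n + 2) ↔ HasImOrder g n := by
  obtain ⟨G, hG⟩ := hg.2
  rw [(hG.augment hq hg.1.2).hasImOrder_iff, hG.hasImOrder_iff]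
  have h1 : (fun x : ℝ => (augExt p q G x).im) =Θ[𝓝[≠] 0] fun x => x ^ 2 * (G x).im := by
    have hc : ContinuousAt (fun z : ℂ => q ^ 2 / Complex.normSq (1 - q * z * G z)) 0 := by
      have hGc := hG.1.continuousAt
      have h2 := (Complex.continuous_normSq.tendsto _).comp
        (show ContinuousAt (fun z : ℂ => 1 - q * z * G z) 0 by fun_prop).tendsto
      exact tendsto_const_nhds.div h2 (by simp)
    have h3 := hc.tendsto.comp tendsto_ofReal_zero_ne
    simp only [mul_zero, zero_mul, sub_zero, map_one, div_one] at h3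
    have h4 : (fun _ : ℝ => (1 : ℝ)) =Θ[𝓝[≠] 0]
        fun x : ℝ => q ^ 2 / Complex.normSq (1 - q * x * G x) :=
      Asymptotics.isTheta_of_div_tendsto_nhds_ne_zero (c := q ^ 2)
        (by simpa [Function.comp_def] using h3) (by positivity)
    have h5 := h4.symm.mul
      (Asymptotics.isTheta_refl (fun x : ℝ => x ^ 2 * (G x).im) (𝓝[≠] 0))
    refine (EventuallyEq.isTheta ?_).trans (h5.trans (EventuallyEq.isTheta ?_))
    · exact Eventually.of_forall fun x => im_augExt_ofReal p q G x
    · exact Eventually.of_forall fun x => one_mul _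
  have hx2 : (fun x : ℝ => x ^ 2) =Θ[𝓝[≠] 0] fun x : ℝ => x ^ 2 := Asymptotics.isTheta_rfl
  constructor
  · intro h
    have h2 := (h1.symm.trans h).div hx2
    refine (EventuallyEq.isTheta ?_).trans (h2.trans (EventuallyEq.isTheta ?_)) <;>
      filter_upwards [self_mem_nhdsWithin] with x hx
    · exact (mul_div_cancel_left₀ _ (pow_ne_zero 2 hx)).symm
    · rw [pow_add, mul_div_cancel_right₀ _ (pow_ne_zero 2 hx)]
  · intro h
    refine h1.trans ((hx2.mul h).trans (EventuallyEq.isTheta (Eventually.of_forall fun x => ?_)))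
    ring

theorem hasImOrder_zero_iff {g : ℍ → ℂ} (hg : IsPickZero g) :
    HasImOrder g 0 ↔ 0 < (taylorCoeff g 0).im := by
  obtain ⟨G, hG⟩ := hg.2
  rw [hG.hasImOrder_iff, hG.taylorCoeff_zero]
  have ht := tendsto_im_extension hG.1
  simp only [pow_zero]
  constructor
  · intro h
    have h0 : 0 ≤ (G 0).im := ge_of_tendsto ht ((hG.im_nonneg hg.1).filter_mono nhdsWithin_le_nhds)
    refine h0.lt_of_ne fun h1 => ?_
    rw [← h1] at ht
    have := tendsto_nhds_unique (h.tendsto_zero_iff.1 ht) tendsto_const_nhds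
    exact zero_ne_one this
  · intro h
    exact (Asymptotics.isTheta_of_div_tendsto_nhds_ne_zero (by simpa using ht) h.ne').symm

theorem HasImOrder.taylorCoeff_zero_im {f : ℍ → ℂ} {n : ℕ} (hn : n ≠ 0) (h : HasImOrder f n) :
    (taylorCoeff f 0).im = 0 := by
  obtain ⟨F, hF, h⟩ := h
  rw [hF.taylorCoeff_zero]
  refine tendsto_nhds_unique (tendsto_im_extension hF.1) (h.tendsto_zero_iff.2 ?_)
  have : Tendsto (fun x : ℝ => x ^ n) (𝓝 0) (𝓝 (0 ^ n)) := (continuous_pow n).tendsto 0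
  rw [zero_pow hn] at this
  exact this.mono_left nhdsWithin_le_nhds

theorem HasImOrder.im_pos {f : ℍ → ℂ} {n : ℕ} (hf : IsPick f) (h : HasImOrder f n) (z : ℍ) :
    0 < (f z).im := by
  refine hf.im_pos_or_const.resolve_right (fun ⟨r, hr⟩ => ?_) z
  have hF : IsExtensionAtZero f fun _ => (r : ℂ) :=
    ⟨analyticAt_const, Eventually.of_forall fun z hz => (hr _).symm⟩
  rw [hF.hasImOrder_iff] at h
  simp only [Complex.ofReal_im, Asymptotics.isTheta_zero_left] at h
  obtain ⟨x, hx, hx0⟩ := (h.and self_mem_nhdsWithin).exists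
  exact pow_ne_zero n hx0 hx

/-! ### Iterated augmentation -/

/-- The augmentation of `g` by `p (m-1), q (m-1)`, then by `p (m-2), q (m-2)`, and so on down to
`p 0, q 0`. -/
noncomputable def augIter : ℕ → (ℕ → ℝ) → (ℕ → ℝ) → (ℍ → ℂ) → ℍ → ℂ
  | 0, _, _, g => g
  | m + 1, p, q, g => aug (p 0) (q 0) (augIter m (fun k => p (k + 1)) (fun k => q (k + 1)) g)

theorem augIter_congr {m : ℕ} {p q p' q' : ℕ → ℝ} (h : ∀ k < m, p k = p' k ∧ q k = q' k)
    (g : ℍ → ℂ) : augIter m p q g = augIter m p' q' g := by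
  induction m generalizing p q p' q' with
  | zero => rfl
  | succ m ih =>
    rw [augIter, augIter, (h 0 m.succ_pos).1, (h 0 m.succ_pos).2,
      ih fun k hk => h (k + 1) (Nat.succ_lt_succ hk)]

theorem IsPickZero.augIter {m : ℕ} {p q : ℕ → ℝ} {g : ℍ → ℂ} (hq : ∀ k < m, 0 < q k)
    (hg : IsPickZero g) : IsPickZero (augIter m p q g) := by
  induction m generalizing p q with
  | zero => exact hg
  | succ m ih =>
    exact (ih fun k hk => hq (k + 1) (Nat.succ_lt_succ hk)).augment (hq 0 m.succ_pos)

theorem augProd_succ (m : ℕ) (p q : ℕ → ℝ) (z : ℂ) :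
    augProd (m + 1) p q z =
      augMatrix (p 0) (q 0) z * augProd m (fun k => p (k + 1)) (fun k => q (k + 1)) z := by
  simp [augProd, List.range_succ_eq_map, Function.comp_def]

/-- Linear fractional transformations compose; no condition on `lft A` is needed, as both sides
have the same junk value when its denominator vanishes. -/
theorem lft_mul (A B : Matrix (Fin 2) (Fin 2) ℂ) {h : ℂ} (hB : B 1 0 * h + B 1 1 ≠ 0) :
    lft (A * B) h = lft A (lft B h) := by
  simp only [lft, Matrix.mul_apply, Fin.sum_univ_two]
  rw [← mul_div_mul_right _ (A 1 0 * _ + _) hB]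
  congr 1
  · field_simp
    ring
  · field_simp
    ring

/-- The matrix product acts as the iterated augmentation. The denominator is carried along in the
induction because `lft` is multiplicative only where it does not vanish. -/
theorem lft_augProd {m : ℕ} {p q : ℕ → ℝ} {g : ℍ → ℂ} (hq : ∀ k < m, 0 < q k)
    (hg : IsPickZero g) (z : ℍ) :
    lft (augProd m p q z) (g z) = augIter m p q g z ∧
      augProd m p q z 1 0 * g z + augProd m p q z 1 1 ≠ 0 := by
  induction m generalizing p q with
  | zero => simp [augProd, lft, PickContact.augIter]
  | succ m ih =>
    have hq' : ∀ k < m, 0 < q (k + 1) := fun k hk => hq (k + 1) (Nat.succ_lt_succ hk)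
    obtain ⟨h1, h2⟩ := ih (p := fun k => p (k + 1)) hq'
    have h3 := one_sub_mul_ne_zero (hq 0 m.succ_pos) z.im_pos
      ((hg.augIter (p := fun k => p (k + 1)) hq').1.2 z)
    rw [augProd_succ]
    refine ⟨by rw [lft_mul _ _ h2, h1, PickContact.augIter, aug], ?_⟩
    rw [← h1, lft] at h3
    generalize augProd m (fun k => p (k + 1)) (fun k => q (k + 1)) z = B at h2 h3
    intro h4
    refine h3 ?_
    simp only [Matrix.mul_apply, Fin.sum_univ_two, augMatrix, Matrix.of_apply, Matrix.cons_val',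
      Matrix.cons_val_zero, Matrix.cons_val_one, Matrix.cons_val_fin_one] at h4
    rw [mul_div_assoc', sub_eq_zero, eq_comm, div_eq_one_iff_eq h2]
    linear_combination h4

theorem hasImOrder_augIter {m : ℕ} {p q : ℕ → ℝ} {g : ℍ → ℂ} (hq : ∀ k < m, 0 < q k)
    (hg : IsPickZero g) (h0 : 0 < (taylorCoeff g 0).im) :
    HasImOrder (augIter m p q g) (2 * m) := by
  induction m generalizing p q with
  | zero => exact (hasImOrder_zero_iff hg).2 h0
  | succ m ih =>
    have hq' : ∀ k < m, 0 < q (k + 1) := fun k hk => hq (k + 1) (Nat.succ_lt_succ hk)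
    exact (hasImOrder_aug_iff (hq 0 m.succ_pos) (hg.augIter hq') (2 * m)).2 (ih hq')

theorem HasImOrder.exists_eq_augIter {m : ℕ} {f : ℍ → ℂ} (hf : IsPickZero f)
    (h : HasImOrder f (2 * m)) :
    ∃ (p q : ℕ → ℝ) (g : ℍ → ℂ), (∀ k < m, 0 < q k) ∧ IsPickZero g ∧
      0 < (taylorCoeff g 0).im ∧ f = augIter m p q g := by
  induction m generalizing f with
  | zero => exact ⟨0, 0, f, by simp, hf, (hasImOrder_zero_iff hf).1 h, rfl⟩
  | succ m ih =>
    obtain ⟨p₀, q₀, hq₀, f₁, hf₁, rfl⟩ :=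
      hf.exists_eq_aug (h.im_pos hf.1) (h.taylorCoeff_zero_im (by omega))
    obtain ⟨p, q, g, hq, hg, hg0, rfl⟩ := ih hf₁ ((hasImOrder_aug_iff hq₀ hf₁ (2 * m)).1 h)
    refine ⟨fun | 0 => p₀ | k + 1 => p k, fun | 0 => q₀ | k + 1 => q k, g, ?_, hg, hg0, rfl⟩
    rintro (_ | k) hk
    · exact hq₀
    · exact hq k (Nat.lt_of_succ_lt_succ hk)

/-- The reductions of an iterated augmentation recover the intermediate augmentations. -/
theorem reduction_iterate_augIter {m : ℕ} {p q : ℕ → ℝ} {g : ℍ → ℂ} (hq : ∀ k < m, 0 < q k)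
    (hg : IsPickZero g) {k : ℕ} (hk : k ≤ m) :
    reduction^[k] (augIter m p q g) =
      augIter (m - k) (fun i => p (i + k)) (fun i => q (i + k)) g := by
  induction k generalizing m p q with
  | zero => rfl
  | succ k ih =>
    obtain ⟨m, rfl⟩ : ∃ j, m = j + 1 := ⟨m - 1, by omega⟩
    have hq' : ∀ k < m, 0 < q (k + 1) := fun k hk => hq (k + 1) (Nat.succ_lt_succ hk)
    rw [Function.iterate_succ_apply, augIter, reduction_aug (hq 0 m.succ_pos) (hg.augIter hq'),
      ih hq' (Nat.le_of_succ_le_succ hk), Nat.add_sub_add_right]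
    rfl

/-! ### Order of contact -/

theorem IsExtensionAtZero.eventually_tendsto_comap {f : ℍ → ℂ} {F : ℂ → ℂ}
    (hF : IsExtensionAtZero f F) :
    ∀ᶠ y : ℂ in 𝓝 0, Tendsto f (comap ((↑) : ℍ → ℂ) (𝓝 y)) (𝓝 (F y)) := by
  filter_upwards [hF.2.eventually_nhds, hF.1.eventually_analyticAt] with y hy hya
  refine Tendsto.congr' ?_ (hya.continuousAt.tendsto.comp tendsto_comap)
  filter_upwards [tendsto_comap.eventually hy] with z hz
  exact hz z.im_pos

theorem tendsto_ofComplex_vertical (x : ℝ) :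
    Tendsto (fun t : ℝ => ofComplex (x + t * Complex.I)) (𝓝[>] 0)
      (comap ((↑) : ℍ → ℂ) (𝓝 (x : ℂ)) ⊓ 𝓟 {z : ℍ | |z.re - x| ≤ 1 * z.im}) := by
  have hc : ∀ᶠ t : ℝ in 𝓝[>] 0, 0 < t ∧
      ((ofComplex (x + t * Complex.I) : ℍ) : ℂ) = x + t * Complex.I := by
    filter_upwards [self_mem_nhdsWithin] with t ht
    have ht : 0 < t := ht
    exact ⟨ht, by rw [ofComplex_apply_of_im_pos (by simpa using ht)]⟩
  refine tendsto_inf.2 ⟨tendsto_comap_iff.2 ?_, tendsto_principal.2 ?_⟩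
  · have ht : Tendsto (fun t : ℝ => (x : ℂ) + t * Complex.I) (𝓝[>] 0) (𝓝 x) := by
      simpa using tendsto_ofReal_mul_I.const_add (x : ℂ)
    refine ht.congr' ?_
    filter_upwards [hc] with t ht
    exact ht.2.symm
  · filter_upwards [hc] with t ht
    have hre := congrArg Complex.re ht.2
    have him := congrArg Complex.im ht.2
    simp only [UpperHalfPlane.coe_re, UpperHalfPlane.coe_im, Complex.add_re, Complex.add_im,
      Complex.mul_re, Complex.mul_im, Complex.ofReal_re, Complex.ofReal_im, Complex.I_re,
      Complex.I_im, mul_zero, mul_one, sub_zero, add_zero, zero_add] at hre him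
    rw [hre, him, sub_self, abs_zero, one_mul]
    exact ht.1.le

theorem IsExtensionAtZero.hasNontangentialLimit_iff {f : ℍ → ℂ} {F : ℂ → ℂ}
    (hF : IsExtensionAtZero f F) :
    ∀ᶠ x : ℝ in 𝓝 0, ∀ w : ℂ, HasNontangentialLimit f x w ↔ w = F x := by
  filter_upwards [tendsto_ofReal_zero.eventually hF.eventually_tendsto_comap] with x hx w
  constructor
  · intro h
    have h1 := (h 1 one_pos).comp (tendsto_ofComplex_vertical x)
    have h2 := (hx.mono_left inf_le_left).comp (tendsto_ofComplex_vertical x)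
    exact tendsto_nhds_unique h1 h2
  · rintro rfl M -
    exact hx.mono_left inf_le_left

/-- For a non-constant function of the class with a real value at `0`, the distance of the boundary
values to that value is comparable to `|x|`. -/
theorem isTheta_sub_extension {f : ℍ → ℂ} {F : ℂ → ℂ} (hf : IsPickZero f)
    (hpos : ∀ z, 0 < (f z).im) (hF : IsExtensionAtZero f F) (h0 : (F 0).im = 0) :
    (fun x : ℝ => ‖F 0 - F x‖) =Θ[𝓝[≠] 0] fun x : ℝ => x := by
  obtain ⟨p, q, hq, g, hg, rfl⟩ := hf.exists_eq_aug hpos (by rwa [hF.taylorCoeff_zero])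
  have hd : deriv F 0 ≠ 0 := by
    rw [← hF.taylorCoeff_one, taylorCoeff_aug_one hq hg]
    exact_mod_cast hq.ne'
  have h2 : HasDerivAt F (deriv F 0) ((0 : ℝ) : ℂ) := by
    simpa using hF.1.differentiableAt.hasDerivAt
  have ht : Tendsto (fun x : ℝ => ((x : ℂ), ((0 : ℝ) : ℂ))) (𝓝[≠] 0)
      (𝓝 ((0 : ℝ) : ℂ) ×ˢ pure ((0 : ℝ) : ℂ)) :=
    (Complex.continuous_ofReal.continuousAt.mono_left nhdsWithin_le_nhds).prodMk
      (tendsto_pure.2 (Eventually.of_forall fun _ => rfl))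
  have h3 := HasDerivAtFilter.isTheta_sub h2 hd
  have h4 : (fun x : ℝ => F x - F 0) =Θ[𝓝[≠] 0] fun x : ℝ => (x : ℂ) := by
    have h5 := And.intro (h3.1.comp_tendsto ht) (h3.2.comp_tendsto ht)
    simpa [Function.comp_def, Asymptotics.IsTheta] using h5
  have h6 : (fun x : ℝ => (x : ℂ)) =Θ[𝓝[≠] 0] fun x : ℝ => x :=
    Asymptotics.IsTheta.of_norm_eventuallyEq_norm (by simp [EventuallyEq])
  simpa [norm_sub_rev] using (h4.trans h6).norm_left

theorem hasContactOrder_iff {f : ℍ → ℂ} (hf : IsPickZero f) {n : ℕ} (hn : n ≠ 0) :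
    HasContactOrder f (n : ℝ) ↔ HasImOrder f n := by
  obtain ⟨F, hF⟩ := hf.2
  constructor
  · rintro ⟨-, ⟨W, hW, -, hWim⟩, L, hL, δ, hδ, C₁, hC₁, C₂, hC₂, hae⟩
    have hpos : ∀ z, 0 < (f z).im := by
      refine hf.1.im_pos_or_const.resolve_right fun ⟨r, hr⟩ => ?_
      obtain ⟨t, ht, ht0⟩ :=
        ((tendsto_ofReal_mul_I.eventually hW).and self_mem_nhdsWithin).exists
      have ht0 : 0 < t := ht0
      have := hWim ⟨t * Complex.I, by simpa using ht0⟩ ht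
      simp [hr] at this
    have hL0 : (L : ℂ) = F 0 := by
      have h1 := tendsto_ofComplex_vertical 0
      have h2 := h1.mono_right inf_le_left
      rw [Complex.ofReal_zero] at h2
      exact tendsto_nhds_unique (hL.comp h2) (hF.eventually_tendsto_comap.self_of_nhds.comp h2)
    have h0 : (F 0).im = 0 := by rw [← hL0, Complex.ofReal_im]
    have hth := isTheta_sub_extension hf hpos hF h0
    rw [hF.hasImOrder_iff]
    obtain ⟨U, hU, hUo, h0U⟩ := eventually_nhds_iff.1 (hF.hasNontangentialLimit_iff.and
      ((tendsto_ofReal_zero.eventually hF.1.eventually_analyticAt).and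
        (gt_mem_nhds hδ |> (continuous_abs.tendsto' (0 : ℝ) 0 abs_zero).eventually)))
    have hdense := Measure.dense_of_ae hae
    -- the two bounds hold almost everywhere near `0`, hence everywhere by continuity
    have hbound : ∀ x ∈ U, C₁ * ‖F 0 - F x‖ ^ n ≤ (F x).im ∧ (F x).im ≤ C₂ * ‖F 0 - F x‖ ^ n := by
      intro x hx
      have hc : ContinuousAt (fun y : ℝ => F y) x :=
        (hU x hx).2.1.continuousAt.comp Complex.continuous_ofReal.continuousAt
      have hu : ContinuousAt (fun y : ℝ => (F y).im) x :=
        Complex.continuous_im.continuousAt.comp hc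
      have hv : ContinuousAt (fun y : ℝ => ‖F 0 - F y‖ ^ n) x :=
        (continuousAt_const.sub hc).norm.pow n
      have hfr : ∃ᶠ y : ℝ in 𝓝 x, C₁ * ‖F 0 - F y‖ ^ n ≤ (F y).im ∧
          (F y).im ≤ C₂ * ‖F 0 - F y‖ ^ n := by
        refine ((mem_closure_iff_frequently.1 (hdense x)).and_eventually
          (hUo.mem_nhds hx)).mono fun y ⟨hy, hyU⟩ => ?_
        obtain ⟨w, hw, h1, h2⟩ := hy (hU y hyU).2.2
        rw [((hU y hyU).1 w).1 hw, hL0, Real.rpow_natCast] at h1 h2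
        -- the quotient is positive, so that its denominator does not vanish
        have hv0 : ‖F 0 - F y‖ ^ n ≠ 0 := fun h => by
          rw [h, div_zero] at h1
          linarith
        have hv1 : 0 < ‖F 0 - F y‖ ^ n := lt_of_le_of_ne (by positivity) hv0.symm
        exact ⟨(le_div_iff₀ hv1).1 h1, (div_le_iff₀ hv1).1 h2⟩
      constructor
      · by_contra! hlt
        obtain ⟨y, hy1, hy2⟩ :=
          (hfr.and_eventually (hu.eventually_lt (hv.const_mul C₁) hlt)).exists
        exact absurd hy1.1 hy2.not_ge
      · by_contra! hlt
        obtain ⟨y, hy1, hy2⟩ :=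
          (hfr.and_eventually ((hv.const_mul C₂).eventually_lt hu hlt)).exists
        exact absurd hy1.2 hy2.not_ge
    refine Asymptotics.IsTheta.trans ⟨?_, ?_⟩ (hth.pow n)
    · refine Asymptotics.IsBigO.of_bound C₂ ?_
      filter_upwards [mem_nhdsWithin_of_mem_nhds (hUo.mem_nhds h0U)] with x hx
      obtain ⟨h1, h2⟩ := hbound x hx
      rw [Real.norm_of_nonneg (le_trans (by positivity) h1), Real.norm_of_nonneg (by positivity)]
      exact h2
    · refine Asymptotics.IsBigO.of_bound C₁⁻¹ ?_
      filter_upwards [mem_nhdsWithin_of_mem_nhds (hUo.mem_nhds h0U)] with x hx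
      obtain ⟨h1, h2⟩ := hbound x hx
      rw [Real.norm_of_nonneg (le_trans (by positivity) h1), Real.norm_of_nonneg (by positivity),
        le_inv_mul_iff₀ hC₁]
      exact h1
  · intro h
    have hpos := h.im_pos hf.1
    have h0 := h.taylorCoeff_zero_im hn
    rw [hF.taylorCoeff_zero] at h0
    obtain ⟨L, hL⟩ : ∃ L : ℝ, F 0 = L := ⟨(F 0).re, Complex.ext (by simp) (by simp [h0])⟩
    have hth := isTheta_sub_extension hf hpos hF h0
    have hcomp : (fun x : ℝ => (F x).im) =Θ[𝓝[≠] 0] fun x => ‖F 0 - F x‖ ^ n :=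
      ((hF.hasImOrder_iff n).1 h).trans (hth.pow n).symm
    obtain ⟨C₂, hC₂, hle⟩ := hcomp.1.exists_pos
    obtain ⟨C₁, hC₁, hge⟩ := hcomp.2.exists_pos
    have hne : ∀ᶠ x : ℝ in 𝓝[≠] 0, ‖F 0 - F x‖ ≠ 0 := by
      filter_upwards [hth.2.eq_zero_imp, self_mem_nhdsWithin] with x hx hx0 h
      exact hx0 (hx h)
    have hev := (((hle.bound.and hge.bound).and hne).and
      ((hF.hasNontangentialLimit_iff.and (hF.im_nonneg hf.1)).filter_mono nhdsWithin_le_nhds))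
    rw [eventually_nhdsWithin_iff, Metric.eventually_nhds_iff] at hev
    obtain ⟨δ, hδ, hev⟩ := hev
    refine ⟨by positivity, ⟨Set.univ, univ_mem, by simpa using hf.1.1, fun z _ => hpos z⟩, L, ?_,
      δ, hδ, C₁⁻¹, inv_pos.2 hC₁, C₂, hC₂, ?_⟩
    · rw [← hL]
      exact hF.eventually_tendsto_comap.self_of_nhds
    · have hx0 : ∀ᵐ x : ℝ, x ≠ 0 := Measure.ae_ne volume 0
      filter_upwards [hx0] with x hx hxδ
      obtain ⟨⟨⟨h1, h2⟩, h3⟩, h4, h5⟩ := hev (by simpa using hxδ) hx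
      refine ⟨F x, (h4 _).2 rfl, ?_⟩
      have hv : 0 < ‖F 0 - F x‖ ^ n := pow_pos (lt_of_le_of_ne (norm_nonneg _) h3.symm) n
      rw [← hL, Real.rpow_natCast, le_div_iff₀ hv, div_le_iff₀ hv]
      rw [Real.norm_of_nonneg h5, Real.norm_of_nonneg hv.le] at h1 h2
      exact ⟨(inv_mul_le_iff₀ hC₁).2 h2, h1⟩

/-! ### Taylor coefficients and uniqueness -/

theorem IsExtensionAtZero.taylorCoeff_eq_iff {f f' : ℍ → ℂ} {F F' : ℂ → ℂ}
    (hF : IsExtensionAtZero f F) (hF' : IsExtensionAtZero f' F') (n : ℕ) :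
    (∀ k < n, taylorCoeff f k = taylorCoeff f' k) ↔ n ≤ analyticOrderAt (F - F') 0 := by
  rw [natCast_le_analyticOrderAt_iff_iteratedDeriv_eq_zero (hF.1.sub hF'.1)]
  refine forall₂_congr fun k _ => ?_
  rw [hF.taylorCoeff_eq, hF'.taylorCoeff_eq,
    iteratedDeriv_sub hF.1.contDiffAt hF'.1.contDiffAt, sub_eq_zero]
  exact div_left_inj' (by exact_mod_cast k.factorial_ne_zero)

/-- Augmentation shifts agreement of Taylor coefficients by two places: the difference of two
augmentations is `z ^ 2` times a unit times the difference of the original functions. -/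
theorem taylorCoeff_aug_eq_iff {p q : ℝ} {g g' : ℍ → ℂ} (hq : 0 < q) (hg : IsPickZero g)
    (hg' : IsPickZero g') (n : ℕ) :
    (∀ k < n + 2, taylorCoeff (aug p q g) k = taylorCoeff (aug p q g') k) ↔
      ∀ k < n, taylorCoeff g k = taylorCoeff g' k := by
  obtain ⟨G, hG⟩ := hg.2
  obtain ⟨G', hG'⟩ := hg'.2
  have hqc : (q : ℂ) ≠ 0 := by exact_mod_cast hq.ne'
  rw [(hG.augment hq hg.1.2).taylorCoeff_eq_iff (hG'.augment hq hg'.1.2),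
    hG.taylorCoeff_eq_iff hG']
  set u : ℂ → ℂ := fun z => q ^ 2 / ((1 - q * z * G z) * (1 - q * z * G' z)) with hu
  have hden : ∀ {H : ℂ → ℂ}, AnalyticAt ℂ H 0 → AnalyticAt ℂ (fun z => 1 - q * z * H z) 0 :=
    fun hH => analyticAt_const.sub ((analyticAt_const.mul analyticAt_id).mul hH)
  have hua : AnalyticAt ℂ u 0 := analyticAt_const.div ((hden hG.1).mul (hden hG'.1)) (by simp)
  have hu0 : analyticOrderAt u 0 = 0 := hua.analyticOrderAt_eq_zero.2 (by simp [hu, hqc])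
  have h2 : analyticOrderAt ((id : ℂ → ℂ) ^ 2) 0 = 2 := by
    rw [analyticOrderAt_pow analyticAt_id, analyticOrderAt_id]
    norm_num
  have he : augExt p q G - augExt p q G' =ᶠ[𝓝 0] (id ^ 2 * u) * (G - G') := by
    filter_upwards [augExt_den_ne_zero (q := q) hG.1.continuousAt,
      augExt_den_ne_zero (q := q) hG'.1.continuousAt] with z h h'
    simp only [augExt, Pi.sub_apply, Pi.mul_apply, Pi.pow_apply, id, hu]
    field_simp
    ring
  rw [analyticOrderAt_congr he, analyticOrderAt_mul ((analyticAt_id.pow 2).mul hua)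
    (hG.1.sub hG'.1), analyticOrderAt_mul (analyticAt_id.pow 2) hua, h2, hu0, add_zero, add_comm 2,
    Nat.cast_add, Nat.cast_two]
  exact ENat.add_le_add_iff_right (by simp)

theorem taylorCoeff_augIter_zero {m : ℕ} {p q : ℕ → ℝ} {g : ℍ → ℂ} (hm : 0 < m)
    (hq : ∀ k < m, 0 < q k) (hg : IsPickZero g) :
    taylorCoeff (augIter m p q g) 0 = p 0 ∧ taylorCoeff (augIter m p q g) 1 = q 0 := by
  obtain ⟨m, rfl⟩ : ∃ j, m = j + 1 := ⟨m - 1, by omega⟩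
  have hg' := hg.augIter (p := fun k => p (k + 1))
    fun k hk => hq (k + 1) (Nat.succ_lt_succ hk)
  exact ⟨taylorCoeff_aug_zero (hq 0 m.succ_pos) hg', taylorCoeff_aug_one (hq 0 m.succ_pos) hg'⟩

theorem taylorCoeff_augIter_eq {m : ℕ} {p q : ℕ → ℝ} {g g' : ℍ → ℂ} (hq : ∀ k < m, 0 < q k)
    (hg : IsPickZero g) (hg' : IsPickZero g') (h0 : taylorCoeff g 0 = taylorCoeff g' 0) :
    ∀ k < 2 * m + 1, taylorCoeff (augIter m p q g) k = taylorCoeff (augIter m p q g') k := by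
  induction m generalizing p q with
  | zero =>
    intro k hk
    obtain rfl : k = 0 := by omega
    exact h0
  | succ m ih =>
    have hq' : ∀ k < m, 0 < q (k + 1) := fun k hk => hq (k + 1) (Nat.succ_lt_succ hk)
    exact (taylorCoeff_aug_eq_iff (hq 0 m.succ_pos) (hg.augIter hq') (hg'.augIter hq') _).2
      (ih hq')

/-- The parameters of an iterated augmentation can be read off from the first `2 m + 1` Taylor
coefficients. -/
theorem augIter_parameters_unique {m : ℕ} {p q p' q' : ℕ → ℝ} {g g' : ℍ → ℂ}
    (hq : ∀ k < m, 0 < q k) (hq' : ∀ k < m, 0 < q' k) (hg : IsPickZero g) (hg' : IsPickZero g')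
    (h : ∀ k < 2 * m + 1,
      taylorCoeff (augIter m p q g) k = taylorCoeff (augIter m p' q' g') k) :
    (∀ k < m, p k = p' k ∧ q k = q' k) ∧ taylorCoeff g 0 = taylorCoeff g' 0 := by
  induction m generalizing p q p' q' with
  | zero => exact ⟨by simp, h 0 (by omega)⟩
  | succ m ih =>
    have hs : ∀ k < m, 0 < q (k + 1) := fun k hk => hq (k + 1) (Nat.succ_lt_succ hk)
    have hs' : ∀ k < m, 0 < q' (k + 1) := fun k hk => hq' (k + 1) (Nat.succ_lt_succ hk)
    have e := taylorCoeff_augIter_zero (p := p) m.succ_pos hq hg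
    have e' := taylorCoeff_augIter_zero (p := p') m.succ_pos hq' hg'
    have hp0 : p 0 = p' 0 := by
      exact_mod_cast e.1.symm.trans ((h 0 (by omega)).trans e'.1)
    have hq0 : q 0 = q' 0 := by
      exact_mod_cast e.2.symm.trans ((h 1 (by omega)).trans e'.2)
    simp only [augIter] at h
    rw [← hp0, ← hq0] at h
    obtain ⟨h1, h2⟩ := ih hs hs' ((taylorCoeff_aug_eq_iff (hq 0 m.succ_pos) (hg.augIter hs)
      (hg'.augIter hs') (2 * m + 1)).1 h)
    refine ⟨?_, h2⟩
    rintro (_ | k) hk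
    · exact ⟨hp0, hq0⟩
    · exact h1 k (Nat.lt_of_succ_lt_succ hk)

/-- Equal iterated augmentations have equal parameters, also when the numbers of steps are not
assumed equal: the value at `0` is real exactly as long as a step remains. -/
theorem augIter_unique {m m' : ℕ} {p q p' q' : ℕ → ℝ} {g g' : ℍ → ℂ}
    (hq : ∀ k < m, 0 < q k) (hq' : ∀ k < m', 0 < q' k) (hg : IsPickZero g) (hg' : IsPickZero g')
    (h0 : 0 < (taylorCoeff g 0).im) (h0' : 0 < (taylorCoeff g' 0).im)
    (h : augIter m p q g = augIter m' p' q' g') :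
    m = m' ∧ (∀ k < m, p k = p' k ∧ q k = q' k) ∧ g = g' := by
  induction m generalizing m' p q p' q' with
  | zero =>
    cases m' with
    | zero => exact ⟨rfl, by simp, h⟩
    | succ m' =>
      have h : g = _ := h
      rw [h, (taylorCoeff_augIter_zero m'.succ_pos hq' hg').1] at h0
      simp at h0
  | succ m ih =>
    cases m' with
    | zero =>
      have h : _ = g' := h
      rw [← h, (taylorCoeff_augIter_zero m.succ_pos hq hg).1] at h0'
      simp at h0'
    | succ m' =>
      have e := taylorCoeff_augIter_zero (p := p) m.succ_pos hq hg
      have e' := taylorCoeff_augIter_zero (p := p') m'.succ_pos hq' hg'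
      rw [h] at e
      have hp0 : p 0 = p' 0 := by exact_mod_cast e.1.symm.trans e'.1
      have hq0 : q 0 = q' 0 := by exact_mod_cast e.2.symm.trans e'.2
      have hr := reduction_iterate_augIter (p := p) hq hg (k := 1) (by omega)
      rw [h, reduction_iterate_augIter hq' hg' (by omega)] at hr
      obtain ⟨rfl, h1, h2⟩ := ih (fun k hk => hq (k + 1) (Nat.succ_lt_succ hk))
        (fun k hk => hq' (k + 1) (Nat.succ_lt_succ hk)) hr.symm
      refine ⟨rfl, ?_, h2⟩
      rintro (_ | k) hk
      · exact ⟨hp0, hq0⟩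
      · exact h1 k (Nat.lt_of_succ_lt_succ hk)

/-! ### A solution of the coefficient problem -/

theorem posDef_map_ofReal {ι : Type*} [Fintype ι] {H : Matrix ι ι ℝ} (hH : H.PosDef) :
    (H.map Complex.ofReal).PosDef := by
  have hherm : (H.map Complex.ofReal).IsHermitian := by
    ext i j
    simpa using congrArg Complex.ofReal (hH.isHermitian.apply i j)
  refine PosDef.of_dotProduct_mulVec_pos hherm fun v hv => ?_
  have hre : (star v ⬝ᵥ H.map Complex.ofReal *ᵥ v).re =
      star (fun i => (v i).re) ⬝ᵥ H *ᵥ (fun i => (v i).re) +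
        star (fun i => (v i).im) ⬝ᵥ H *ᵥ (fun i => (v i).im) := by
    simp only [dotProduct, mulVec, Complex.re_sum, Finset.mul_sum, ← Finset.sum_add_distrib]
    refine Finset.sum_congr rfl fun i _ => Finset.sum_congr rfl fun j _ => ?_
    simp
  have him : (star v ⬝ᵥ H.map Complex.ofReal *ᵥ v).im = 0 :=
    hherm.im_star_dotProduct_mulVec_self v
  rw [Complex.lt_def, hre, him]
  refine ⟨?_, rfl⟩
  have h1 := hH.posSemidef.dotProduct_mulVec_nonneg (fun i => (v i).re)
  have h2 := hH.posSemidef.dotProduct_mulVec_nonneg (fun i => (v i).im)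
  simp only [Complex.zero_re]
  by_cases hx : (fun i => (v i).re) = 0
  · have hy : (fun i => (v i).im) ≠ 0 := fun hy =>
      hv (funext fun i => Complex.ext (congrFun hx i) (congrFun hy i))
    have := hH.dotProduct_mulVec_pos hy
    linarith
  · have := hH.dotProduct_mulVec_pos hx
    linarith

/-- The identity from which both the invertibility of `A - z S` and the sign of the imaginary part
of `z ⟪A e, (1 - z A⁻¹ S)⁻¹ e⟫` are read off. -/
theorem im_star_dotProduct_pencil {ι : Type*} [Fintype ι] {A S : Matrix ι ι ℂ}
    (hA : A.PosDef) (z : ℂ) (v : ι → ℂ) :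
    (z * star (star v ⬝ᵥ (A - z • S) *ᵥ v)).im =
      z.im * (star v ⬝ᵥ A *ᵥ v).re + Complex.normSq z * (star v ⬝ᵥ S *ᵥ v).im := by
  have h0 : (star v ⬝ᵥ A *ᵥ v).im = 0 := hA.isHermitian.im_star_dotProduct_mulVec_self v
  rw [sub_mulVec, smul_mulVec, dotProduct_sub, dotProduct_smul, smul_eq_mul]
  simp only [star_sub, star_mul', Complex.star_def, Complex.mul_im, Complex.mul_re, Complex.sub_re,
    Complex.sub_im, Complex.conj_re, Complex.conj_im, h0, Complex.normSq_apply]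
  ring

section resolvent

variable {ι : Type*} [Fintype ι] [DecidableEq ι]

theorem analyticAt_det {M : ℂ → Matrix ι ι ℂ} {z : ℂ}
    (hM : ∀ i j, AnalyticAt ℂ (fun w => M w i j) z) : AnalyticAt ℂ (fun w => (M w).det) z := by
  simp only [det_apply']
  exact Finset.analyticAt_fun_sum _ fun σ _ =>
    analyticAt_const.mul (Finset.analyticAt_fun_prod _ fun i _ => hM _ _)

theorem analyticAt_inv_apply {M : ℂ → Matrix ι ι ℂ} {z : ℂ}
    (hM : ∀ i j, AnalyticAt ℂ (fun w => M w i j) z) (h0 : (M z).det ≠ 0) (i j : ι) :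
    AnalyticAt ℂ (fun w => (M w)⁻¹ i j) z := by
  simp only [inv_def, Matrix.smul_apply, Ring.inverse_eq_inv', smul_eq_mul, adjugate_apply]
  refine ((analyticAt_det hM).inv h0).mul (analyticAt_det fun k l => ?_)
  by_cases hk : k = j
  · subst hk
    simpa using analyticAt_const
  · simpa [updateRow_ne hk] using hM k l

variable {A S : Matrix ι ι ℂ}

theorem mul_one_sub_smul_inv_mul (hA : A.PosDef) (z : ℂ) :
    A * (1 - z • (A⁻¹ * S)) = A - z • S := by
  rw [mul_sub, mul_one, mul_smul_comm, mul_nonsing_inv_cancel_left _ _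
    ((isUnit_iff_isUnit_det A).1 hA.isUnit)]

/-- `A - z S` is invertible for `z` in the upper half-plane, if `S` has nonnegative imaginary
part. -/
theorem det_one_sub_smul_ne_zero (hA : A.PosDef) (hS : ∀ v : ι → ℂ, 0 ≤ (star v ⬝ᵥ S *ᵥ v).im)
    {z : ℂ} (hz : 0 < z.im) : (1 - z • (A⁻¹ * S)).det ≠ 0 := by
  intro hdet
  obtain ⟨v, hv, hv0⟩ := exists_mulVec_eq_zero_iff.2 hdet
  have h1 : (A - z • S) *ᵥ v = 0 := by
    rw [← mul_one_sub_smul_inv_mul hA, ← mulVec_mulVec, hv0, mulVec_zero]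
  have h2 := im_star_dotProduct_pencil (S := S) hA z v
  rw [h1, dotProduct_zero, star_zero, mul_zero, Complex.zero_im] at h2
  have h3 := mul_pos hz (hA.re_dotProduct_pos hv)
  have h4 := mul_nonneg (Complex.normSq_nonneg z) (hS v)
  simp only [RCLike.re_eq_complex_re] at h3
  linarith

theorem im_mul_resolvent_nonneg (hA : A.PosDef) (hS : ∀ v : ι → ℂ, 0 ≤ (star v ⬝ᵥ S *ᵥ v).im)
    {z : ℂ} (hz : 0 < z.im) (e : ι → ℂ) :
    0 ≤ (z * (star (A *ᵥ e) ⬝ᵥ (1 - z • (A⁻¹ * S))⁻¹ *ᵥ e)).im := by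
  have hdet : IsUnit (1 - z • (A⁻¹ * S)).det := (det_one_sub_smul_ne_zero hA hS hz).isUnit
  set v := (1 - z • (A⁻¹ * S))⁻¹ *ᵥ e with hv
  have h1 : A *ᵥ e = (A - z • S) *ᵥ v := by
    rw [← mul_one_sub_smul_inv_mul hA, ← mulVec_mulVec, hv, mulVec_mulVec _ (1 - _),
      mul_nonsing_inv _ hdet, one_mulVec]
  have h2 : star (A *ᵥ e) ⬝ᵥ v = star (star v ⬝ᵥ (A - z • S) *ᵥ v) := by
    rw [h1, star_dotProduct]
  rw [h2, im_star_dotProduct_pencil hA]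
  have h3 := mul_nonneg hz.le (hA.posSemidef.re_dotProduct_nonneg v)
  have h4 := mul_nonneg (Complex.normSq_nonneg z) (hS v)
  simp only [RCLike.re_eq_complex_re] at h3
  linarith

end resolvent

/-- Taylor coefficients are determined by any expansion with an analytic remainder. -/
theorem IsExtensionAtZero.taylorCoeff_of_expansion {f : ℍ → ℂ} {F R : ℂ → ℂ} {n : ℕ} {b : ℕ → ℂ}
    (hF : IsExtensionAtZero f F) (hR : AnalyticAt ℂ R 0)
    (h : ∀ᶠ z in 𝓝 0, F z = ∑ k ∈ Finset.range n, b k * z ^ k + z ^ n * R z) :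
    ∀ k < n, taylorCoeff f k = b k := by
  have hP : AnalyticAt ℂ (fun z : ℂ => ∑ k ∈ Finset.range n, b k * z ^ k) 0 :=
    Finset.analyticAt_fun_sum _ fun k _ => analyticAt_const.mul (analyticAt_id.pow k)
  have ho : (n : ℕ∞) ≤
      analyticOrderAt (F - fun z : ℂ => ∑ k ∈ Finset.range n, b k * z ^ k) 0 := by
    rw [natCast_le_analyticOrderAt (hF.1.sub hP)]
    refine ⟨R, hR, ?_⟩
    filter_upwards [h] with z hz
    simp [hz]
  rw [natCast_le_analyticOrderAt_iff_iteratedDeriv_eq_zero (hF.1.sub hP)] at ho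
  intro k hk
  have h1 := ho k hk
  rw [iteratedDeriv_sub hF.1.contDiffAt hP.contDiffAt, sub_eq_zero] at h1
  rw [hF.taylorCoeff_eq, h1, div_eq_iff (by exact_mod_cast k.factorial_ne_zero)]
  rw [iteratedDeriv_fun_sum fun i _ => by fun_prop]
  simp only [iteratedDeriv_const_mul_field, iteratedDeriv_fun_pow_zero]
  simp [hk]

section moments

variable {m : ℕ} {b : ℕ → ℂ} {A S : Matrix (Fin m) (Fin m) ℂ}

/-- With `A` and `S` the Hankel matrix of `b` and its shift, `A⁻¹ S` moves each basis vector to the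
next one, and it is symmetric for the bilinear form `A`, so that half of the factors of a power can
be moved to the left entry. -/
theorem hankel_moments (hm : 0 < m) (hA : ∀ i j, A i j = b (i.val + j.val + 1))
    (hS : ∀ i j, S i j = b (i.val + j.val + 2)) (hdet : IsUnit A.det) {k : ℕ} (hk : k < 2 * m) :
    A *ᵥ Pi.single ⟨0, hm⟩ 1 ⬝ᵥ (A⁻¹ * S) ^ k *ᵥ Pi.single ⟨0, hm⟩ 1 = b (k + 1) := by
  set J := A⁻¹ * S with hJ
  have hAT : Aᵀ = A := by ext i j; simp [hA, add_comm]
  have hST : Sᵀ = S := by ext i j; simp [hS, add_comm]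
  have hshift : ∀ i (h : i + 1 < m), S *ᵥ Pi.single ⟨i, by omega⟩ 1 =
      A *ᵥ Pi.single ⟨i + 1, h⟩ 1 := by
    intro i h
    ext j
    simp only [mulVec_single_one, col_apply, hA, hS]
    congr 1
  have hcol : ∀ i (h : i < m), J ^ i *ᵥ Pi.single ⟨0, hm⟩ 1 = Pi.single ⟨i, h⟩ 1 := by
    intro i
    induction i with
    | zero => intro h; rw [pow_zero, one_mulVec]
    | succ i ih =>
      intro h
      rw [pow_succ', ← mulVec_mulVec, ih (by omega), hJ, ← mulVec_mulVec, hshift i h,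
        mulVec_mulVec, nonsing_inv_mul _ hdet, one_mulVec]
  have hadj : ∀ x w : Fin m → ℂ, A *ᵥ x ⬝ᵥ J *ᵥ w = S *ᵥ x ⬝ᵥ w := by
    intro x w
    have e1 : ∀ {B : Matrix (Fin m) (Fin m) ℂ}, Bᵀ = B → ∀ y, B *ᵥ x ⬝ᵥ y = x ⬝ᵥ B *ᵥ y := by
      intro B hB y
      rw [dotProduct_mulVec, ← mulVec_transpose, hB]
    rw [e1 hAT, e1 hST, mulVec_mulVec, hJ, mul_nonsing_inv_cancel_left _ _ hdet]
  have hrow : ∀ i (h : i < m) (w : Fin m → ℂ),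
      A *ᵥ Pi.single ⟨0, hm⟩ 1 ⬝ᵥ J ^ i *ᵥ w = A *ᵥ Pi.single ⟨i, h⟩ 1 ⬝ᵥ w := by
    intro i
    induction i with
    | zero => intro h w; simp
    | succ i ih =>
      intro h w
      rw [pow_succ, ← mulVec_mulVec, ih (by omega), hadj, hshift i h]
  rcases k with _ | k
  · rw [pow_zero, one_mulVec, dotProduct_single_one, mulVec_single_one, col_apply, hA]
    congr 1
  · obtain ⟨i, j, hi, hj, rfl⟩ : ∃ i j, i < m ∧ j < m ∧ k = i + j :=
      ⟨min k (m - 1), k - min k (m - 1), by omega, by omega, by omega⟩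
    rw [show i + j + 1 = i + 1 + j by omega, pow_add, pow_succ, ← mulVec_mulVec, ← mulVec_mulVec,
      hcol j hj, hrow i hi, hadj]
    simp only [mulVec_single_one, dotProduct_single_one, col_apply, hS]
    congr 1
    omega

end moments

theorem analyticAt_resolvent {ι : Type*} [Fintype ι] [DecidableEq ι] (J : Matrix ι ι ℂ)
    (c e : ι → ℂ) {z : ℂ} (hz : (1 - z • J).det ≠ 0) :
    AnalyticAt ℂ (fun w => c ⬝ᵥ (1 - w • J)⁻¹ *ᵥ e) z := by
  simp only [dotProduct, mulVec]
  refine Finset.analyticAt_fun_sum _ fun i _ => analyticAt_const.mul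
    (Finset.analyticAt_fun_sum _ fun j _ => (analyticAt_inv_apply (fun k l => ?_) hz i j).mul
      analyticAt_const)
  simp only [Matrix.sub_apply, Matrix.smul_apply, smul_eq_mul]
  exact analyticAt_const.sub (analyticAt_id.mul analyticAt_const)

theorem inv_one_sub_smul_eq {ι : Type*} [Fintype ι] [DecidableEq ι] (J : Matrix ι ι ℂ) {z : ℂ}
    (hz : (1 - z • J).det ≠ 0) (n : ℕ) :
    (1 - z • J)⁻¹ = ∑ k ∈ Finset.range n, z ^ k • J ^ k + z ^ n • (J ^ n * (1 - z • J)⁻¹) := by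
  have h := congrArg (· * (1 - z • J)⁻¹) (geom_sum_mul_neg (z • J) n)
  simp only [mul_assoc, mul_nonsing_inv _ hz.isUnit, mul_one, sub_mul, one_mul, smul_pow,
    smul_mul_assoc] at h
  rw [h, sub_add_cancel]

/-- A solution of the coefficient problem is the function
`z ↦ a₀ + z ⟪A e, (1 - z A⁻¹ S)⁻¹ e⟫`, where `A` is the Hankel matrix of `a₁, …, a_{2m-1}`, `S` the
shifted Hankel matrix with the non-real entry `α` in its last corner, and `e` the first basis
vector. -/
theorem exists_hasInitialCoeffs {m : ℕ} (hm : 1 ≤ m) {a : ℕ → ℝ} {α : ℂ} (hα : 0 < α.im)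
    (hH : (hankel m a).PosDef) :
    ∃ f : ℍ → ℂ, IsPickZero f ∧ HasInitialCoeffs f (2 * m) a α := by
  have hm : 0 < m := hm
  set b : ℕ → ℂ := fun k => if k = 2 * m then α else a k with hb
  set A := (hankel m a).map Complex.ofReal with hAdef
  set S : Matrix (Fin m) (Fin m) ℂ := Matrix.of fun i j => b (i.val + j.val + 2) with hSdef
  have hA : A.PosDef := posDef_map_ofReal hH
  have hAb : ∀ i j, A i j = b (i.val + j.val + 1) := by
    intro i j
    have h := i.isLt
    have h' := j.isLt
    simp [hAdef, hankel, hb, show i.val + j.val + 1 ≠ 2 * m by omega]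
  have hS : ∀ v : Fin m → ℂ, 0 ≤ (star v ⬝ᵥ S *ᵥ v).im := by
    intro v
    -- only the last corner of `S` is not real
    set T : Matrix (Fin m) (Fin m) ℂ := Matrix.of fun i j =>
      if i.val + j.val + 2 = 2 * m then 0 else (a (i.val + j.val + 2) : ℂ) with hT
    set d : Fin m → ℂ := fun i => if i.val + 1 = m then α else 0 with hd
    have hTh : T.IsHermitian := by
      ext i j
      simp only [hT, conjTranspose_apply, of_apply, add_comm j.val i.val]
      split_ifs <;> simp
    have hSTd : S = T + diagonal d := by
      ext i j
      have h := i.isLt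
      have h' := j.isLt
      by_cases hij : i.val + j.val + 2 = 2 * m
      · obtain rfl : i = j := Fin.ext (by omega)
        simp [hSdef, hT, hb, hd, hij, show i.val + 1 = m by omega]
      · by_cases hij' : i = j
        · subst hij'
          simp [hSdef, hT, hb, hd, hij, show i.val + 1 ≠ m by omega]
        · simp [hSdef, hT, hb, hij, hij']
    have hT0 : (star v ⬝ᵥ T *ᵥ v).im = 0 := hTh.im_star_dotProduct_mulVec_self v
    rw [hSTd, add_mulVec, dotProduct_add, Complex.add_im, hT0, zero_add, dotProduct, Complex.im_sum]
    refine Finset.sum_nonneg fun i _ => ?_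
    have hdi : 0 ≤ (d i).im := by
      simp only [hd]
      split_ifs
      · exact hα.le
      · exact le_rfl
    have : (star v i * (diagonal d *ᵥ v) i).im = Complex.normSq (v i) * (d i).im := by
      simp [mulVec_diagonal, Complex.normSq_apply]
      ring
    rw [this]
    exact mul_nonneg (Complex.normSq_nonneg _) hdi
  set e : Fin m → ℂ := Pi.single ⟨0, hm⟩ 1 with he
  set J := A⁻¹ * S with hJ
  have hreal : star (A *ᵥ e) = A *ᵥ e := by
    ext i
    simp [he, hAdef]
  set F : ℂ → ℂ := fun z => a 0 + z * (A *ᵥ e ⬝ᵥ (1 - z • J)⁻¹ *ᵥ e) with hF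
  have hFan : ∀ z, (1 - z • J).det ≠ 0 → AnalyticAt ℂ F z := fun z hz =>
    analyticAt_const.add (analyticAt_id.mul (analyticAt_resolvent J _ _ hz))
  have hext : IsExtensionAtZero (fun z : ℍ => F z) F :=
    ⟨hFan 0 (by simp), Eventually.of_forall fun _ _ => rfl⟩
  have hpick : IsPickZero (fun z : ℍ => F z) := by
    refine ⟨⟨?_, fun z => ?_⟩, F, hext⟩
    · refine DifferentiableOn.congr (f := F) (fun z hz => (hFan z
        (det_one_sub_smul_ne_zero hA hS hz)).differentiableAt.differentiableWithinAt)
        fun z hz => ?_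
      rw [ofComplex_apply_of_im_pos hz]
    · have := im_mul_resolvent_nonneg hA hS z.im_pos e
      rw [hreal] at this
      simpa [hF] using this
  have hcoeff : ∀ k < 2 * m + 1, taylorCoeff (fun z : ℍ => F z) k = b k := by
    refine hext.taylorCoeff_of_expansion
      (R := fun z => (A *ᵥ e) ᵥ* J ^ (2 * m) ⬝ᵥ (1 - z • J)⁻¹ *ᵥ e)
      (analyticAt_resolvent J _ _ (by simp)) ?_
    have hne : ∀ᶠ z : ℂ in 𝓝 0, (1 - z • J).det ≠ 0 := by
      refine (analyticAt_det (M := fun z => 1 - z • J)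
        fun i j => ?_).continuousAt.eventually_ne (by simp)
      simp only [Matrix.sub_apply, Matrix.smul_apply, smul_eq_mul]
      exact analyticAt_const.sub (analyticAt_id.mul analyticAt_const)
    filter_upwards [hne] with z hz
    have hb0 : (a 0 : ℂ) = b 0 := by simp [hb, hm.ne']
    have hmom : ∀ k ∈ Finset.range (2 * m), A *ᵥ e ⬝ᵥ (z ^ k • J ^ k) *ᵥ e = z ^ k * b (k + 1) := by
      intro k hk
      rw [smul_mulVec, dotProduct_smul, smul_eq_mul, hJ, he, hankel_moments hm hAb
        (show ∀ i j, S i j = b (i.val + j.val + 2) from fun _ _ => rfl)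
        ((isUnit_iff_isUnit_det A).1 hA.isUnit) (Finset.mem_range.1 hk)]
    have hres : A *ᵥ e ⬝ᵥ (1 - z • J)⁻¹ *ᵥ e = ∑ k ∈ Finset.range (2 * m), z ^ k * b (k + 1) +
        z ^ (2 * m) * ((A *ᵥ e) ᵥ* J ^ (2 * m) ⬝ᵥ (1 - z • J)⁻¹ *ᵥ e) := by
      conv_lhs => rw [inv_one_sub_smul_eq J hz (2 * m)]
      rw [add_mulVec, dotProduct_add, sum_mulVec, dotProduct_sum, Finset.sum_congr rfl hmom,
        smul_mulVec, dotProduct_smul, ← mulVec_mulVec, dotProduct_mulVec, smul_eq_mul]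
    simp only [hF]
    rw [hres, hb0, Finset.sum_range_succ', mul_add, Finset.mul_sum, pow_zero, mul_one, pow_succ]
    have : ∀ k ∈ Finset.range (2 * m), z * (z ^ k * b (k + 1)) = b (k + 1) * z ^ (k + 1) :=
      fun k _ => by ring
    rw [Finset.sum_congr rfl this]
    ring
  refine ⟨_, hpick, fun k hk => ?_, ?_⟩
  · rw [hcoeff k (by omega)]
    simp [hb, hk.ne]
  · rw [hcoeff _ (by omega)]
    simp [hb]

/-- If the first Taylor coefficients are real below order `n` and the next one is not, the
imaginary part on the real axis is governed by the latter. -/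
theorem HasInitialCoeffs.hasImOrder {f : ℍ → ℂ} {n : ℕ} {a : ℕ → ℝ} {α : ℂ} (hf : IsPickZero f)
    (hα : α.im ≠ 0) (h : HasInitialCoeffs f n a α) : HasImOrder f n := by
  obtain ⟨F, hF⟩ := hf.2
  rw [hF.hasImOrder_iff]
  obtain ⟨R, hR, hFR⟩ := hF.1.exists_eq_sum_add_pow_mul (n + 1)
  have him : ∀ x : ℝ, (F x).im = x ^ n * (α + x * R x).im := by
    intro x
    have hs : ∀ k ∈ Finset.range n,
        ((x : ℂ) ^ k / k.factorial) • iteratedDeriv k F 0 = ((x ^ k * a k : ℝ) : ℂ) := by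
      intro k hk
      have := h.1 k (Finset.mem_range.1 hk)
      rw [hF.taylorCoeff_eq] at this
      push_cast
      rw [← this, smul_eq_mul]
      ring
    have hn := h.2
    rw [hF.taylorCoeff_eq] at hn
    have e : F x = ((∑ k ∈ Finset.range n, x ^ k * a k : ℝ) : ℂ) +
        ((x ^ n : ℝ) : ℂ) * (α + x * R x) := by
      rw [hFR, Finset.sum_range_succ, Finset.sum_congr rfl hs, ← hn]
      push_cast
      simp only [smul_eq_mul]
      ring
    rw [e, Complex.add_im, Complex.ofReal_im, Complex.im_ofReal_mul, zero_add]
  have hc : Tendsto (fun x : ℝ => (α + x * R x).im) (𝓝[≠] 0) (𝓝 α.im) := by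
    have h1 : ContinuousAt (fun z : ℂ => α + z * R z) 0 := by
      have := hR.continuousAt
      fun_prop
    have h2 := (Complex.continuous_im.tendsto _).comp (h1.tendsto.comp tendsto_ofReal_zero_ne)
    simpa [Function.comp_def] using h2
  simp only [him]
  have h1 := (Asymptotics.isTheta_refl (fun x : ℝ => x ^ n) (𝓝[≠] 0)).mul
    (Asymptotics.isTheta_of_div_tendsto_nhds_ne_zero (f := fun _ : ℝ => (1 : ℝ))
      (by simpa using hc) hα).symm
  simpa using h1

theorem HasInitialCoeffs.congr_iff {f f' : ℍ → ℂ} {n : ℕ} {a : ℕ → ℝ} {α : ℂ}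
    (h : HasInitialCoeffs f n a α) :
    HasInitialCoeffs f' n a α ↔ ∀ k < n + 1, taylorCoeff f' k = taylorCoeff f k := by
  constructor
  · intro h' k hk
    rcases Nat.lt_succ_iff_lt_or_eq.1 hk with hk | rfl
    · rw [h.1 k hk, h'.1 k hk]
    · rw [h.2, h'.2]
  · intro h'
    exact ⟨fun k hk => by rw [h' k (by omega), h.1 k hk], by rw [h' n (by omega), h.2]⟩

/-! ### Parametrization of the solutions -/

theorem hasContactOrder_iff_exists_augProd {m : ℕ} (hm : 1 ≤ m) (f : ℍ → ℂ) :
    (IsPickZero f ∧ HasContactOrder f ((2 * m : ℕ) : ℝ)) ↔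
      ∃ (p q : ℕ → ℝ) (g : ℍ → ℂ), (∀ k < m, 0 < q k) ∧ IsPickZero g ∧
        0 < (taylorCoeff g 0).im ∧ ∀ z : ℍ, f z = lft (augProd m p q z) (g z) := by
  constructor
  · rintro ⟨hf, hc⟩
    obtain ⟨p, q, g, hq, hg, hg0, rfl⟩ :=
      ((hasContactOrder_iff hf (by omega)).1 hc).exists_eq_augIter hf
    exact ⟨p, q, g, hq, hg, hg0, fun z => (lft_augProd hq hg z).1.symm⟩
  · rintro ⟨p, q, g, hq, hg, hg0, h⟩
    obtain rfl : f = augIter m p q g := funext fun z => (h z).trans (lft_augProd hq hg z).1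
    have hf := hg.augIter (p := p) hq
    exact ⟨hf, (hasContactOrder_iff hf (by omega)).2 (hasImOrder_augIter hq hg hg0)⟩

/-- The parameters are taken from one solution; agreement of the first `2 m + 1` coefficients passes
them on to all others. -/
theorem exists_parametrization {m : ℕ} (hm : 1 ≤ m) {a : ℕ → ℝ} {α : ℂ} (hα : 0 < α.im)
    (hH : (hankel m a).PosDef) :
    ∃ (p q : ℕ → ℝ) (w : ℂ), (∀ k < m, 0 < q k) ∧ 0 < w.im ∧
      (∃ F, IsPickZero F ∧ HasInitialCoeffs F (2 * m) a α) ∧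
      ∀ f, (IsPickZero f ∧ HasInitialCoeffs f (2 * m) a α) ↔
        ∃ g, IsPickZero g ∧ taylorCoeff g 0 = w ∧ f = augIter m p q g := by
  obtain ⟨F, hF, hFc⟩ := exists_hasInitialCoeffs hm hα hH
  obtain ⟨p, q, g₀, hq, hg₀, hw, rfl⟩ := (hFc.hasImOrder hF hα.ne').exists_eq_augIter hF
  refine ⟨p, q, taylorCoeff g₀ 0, hq, hw, ⟨_, hF, hFc⟩, fun f => ⟨?_, ?_⟩⟩
  · rintro ⟨hf, hfc⟩
    obtain ⟨p', q', g, hq', hg, -, rfl⟩ := (hfc.hasImOrder hf hα.ne').exists_eq_augIter hf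
    obtain ⟨h1, h2⟩ := augIter_parameters_unique hq' hq hg hg₀ (hFc.congr_iff.1 hfc)
    exact ⟨g, hg, h2, augIter_congr h1 g⟩
  · rintro ⟨g, hg, hgw, rfl⟩
    exact ⟨hg.augIter hq, hFc.congr_iff.2 (taylorCoeff_augIter_eq hq hg hg₀ hgw)⟩

end PickContact

theorem mainTheorem8 :
    -- characterization of order of contact `2m`
    (∀ (m : ℕ), 1 ≤ m → ∀ f : UpperHalfPlane → ℂ,
      (PickContact.IsPickZero f ∧ PickContact.HasContactOrder f ((2 * m : ℕ) : ℝ)) ↔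
        ∃ (p q : ℕ → ℝ) (g : UpperHalfPlane → ℂ),
          (∀ k < m, 0 < q k) ∧
          PickContact.IsPickZero g ∧ 0 < (PickContact.taylorCoeff g 0).im ∧
          ∀ z : UpperHalfPlane, f z = PickContact.lft (PickContact.augProd m p q z) (g z)) ∧
    -- uniqueness of the representation (only the first `m` entries of `p`, `q` occur in it)
    (∀ (m m' : ℕ), 1 ≤ m → 1 ≤ m' → ∀ (f : UpperHalfPlane → ℂ)
      (p q p' q' : ℕ → ℝ) (g g' : UpperHalfPlane → ℂ),
      (∀ k < m, 0 < q k) → (∀ k < m', 0 < q' k) →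
      PickContact.IsPickZero g → 0 < (PickContact.taylorCoeff g 0).im →
      PickContact.IsPickZero g' → 0 < (PickContact.taylorCoeff g' 0).im →
      (∀ z : UpperHalfPlane, f z = PickContact.lft (PickContact.augProd m p q z) (g z)) →
      (∀ z : UpperHalfPlane, f z = PickContact.lft (PickContact.augProd m' p' q' z) (g' z)) →
      m = m' ∧ (∀ k < m, p k = p' k ∧ q k = q' k) ∧ g = g') ∧
    -- parametrization of the solutions with prescribed initial Taylor coefficients
    (∀ (m : ℕ), 1 ≤ m → ∀ (a : ℕ → ℝ) (α : ℂ), 0 < α.im → (PickContact.hankel m a).PosDef →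
      ∃ (p q : ℕ → ℝ) (w : ℂ),
        p 0 = a 0 ∧ q 0 = a 1 ∧ (∀ k < m, 0 < q k) ∧ 0 < w.im ∧
        -- the parameters are those produced by successive reductions of any solution
        (∃ F : UpperHalfPlane → ℂ,
          PickContact.IsPickZero F ∧ PickContact.HasInitialCoeffs F (2 * m) a α) ∧
        (∀ F : UpperHalfPlane → ℂ,
          PickContact.IsPickZero F → PickContact.HasInitialCoeffs F (2 * m) a α →
          (∀ k ≤ m, PickContact.IsPickZero (PickContact.reduction^[k] F)) ∧
          (∀ k < m, PickContact.taylorCoeff (PickContact.reduction^[k] F) 0 = (p k : ℂ) ∧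
            PickContact.taylorCoeff (PickContact.reduction^[k] F) 1 = (q k : ℂ)) ∧
          PickContact.taylorCoeff (PickContact.reduction^[m] F) 0 = w) ∧
        ∀ f : UpperHalfPlane → ℂ,
          (PickContact.IsPickZero f ∧ PickContact.HasInitialCoeffs f (2 * m) a α) ↔
            ∃ g : UpperHalfPlane → ℂ,
              PickContact.IsPickZero g ∧ PickContact.taylorCoeff g 0 = w ∧
              ∀ z : UpperHalfPlane,
                f z = PickContact.lft (PickContact.augProd m p q z) (g z)) := by
  open PickContact in
  refine ⟨fun m hm f => hasContactOrder_iff_exists_augProd hm f, ?_, ?_⟩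
  · intro m m' _ _ f p q p' q' g g' hq hq' hg hg0 hg' hg0' h h'
    refine augIter_unique hq hq' hg hg' hg0 hg0' (funext fun z => ?_)
    rw [← (lft_augProd hq hg z).1, ← (lft_augProd hq' hg' z).1, ← h, ← h']
  · intro m hm a α hα hH
    obtain ⟨p, q, w, hq, hw, ⟨F, hF, hFc⟩, hiff⟩ := exists_parametrization hm hα hH
    have h01 : p 0 = a 0 ∧ q 0 = a 1 := by
      obtain ⟨g, hg, -, rfl⟩ := (hiff F).1 ⟨hF, hFc⟩
      obtain ⟨h0, h1⟩ := taylorCoeff_augIter_zero (p := p) hm hq hg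
      rw [hFc.1 0 (by omega)] at h0
      rw [hFc.1 1 (by omega)] at h1
      exact ⟨by exact_mod_cast h0.symm, by exact_mod_cast h1.symm⟩
    refine ⟨p, q, w, h01.1, h01.2, hq, hw, ⟨F, hF, hFc⟩, ?_, fun f => ?_⟩
    · intro f hf hfc
      obtain ⟨g, hg, hgw, rfl⟩ := (hiff f).1 ⟨hf, hfc⟩
      have hshift : ∀ k, ∀ i < m - k, 0 < q (i + k) := fun k i hi => hq _ (by omega)
      refine ⟨fun k hk => ?_, fun k hk => ?_, ?_⟩
      · rw [reduction_iterate_augIter hq hg hk]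
        exact hg.augIter (hshift k)
      · rw [reduction_iterate_augIter hq hg hk.le]
        simpa using taylorCoeff_augIter_zero (p := fun i => p (i + k)) (by omega) (hshift k) hg
      · rw [reduction_iterate_augIter hq hg le_rfl, Nat.sub_self]
        exact hgw
    · rw [hiff f]
      refine exists_congr fun g => and_congr_right fun hg => and_congr_right fun _ => ?_
      rw [funext_iff]
      exact forall_congr' fun z => by rw [(lft_augProd hq hg z).1]
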